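/- Let $\mathbb{H}$ be the quaternions, $\mathbb{B}=\{q\in\mathbb{H}: |q|<1\}$, $\mathbb{S}=\{I\in\mathbb{H}: I^2=-1\}$, and for $I\in\mathbb{S}$ let $L_I=\mathbb{R}+\mathbb{R}I$ and $\mathbb{B}_I=\mathbb{B}\cap L_I$. A function $f:\mathbb{B}\to\mathbb{H}$ is *slice regular* if for every $I\in\mathbb{S}$ its restriction to $\mathbb{B}_I$ has continuous partial derivatives and satisfies $\frac12\big(\frac{\partial}{\partial x}+I\frac{\partial}{\partial y}\big)f(x+yI)=0$ on $\mathbb{B}_I$; then $f(q)=\sum_{n\ge0}q^na_n$ with $a_n=\frac1{n!}\frac{\partial^n f}{\partial x^n}(0)$. If $a_N$ is the first non-vanishing coefficient, put $b_n=a_na_N^{-1}|a_N|$ for all $n$ (and $b_n=0$ for all $n$ if $f=0$). For $w_1,w_2,w_3\in\overline{\mathbb{B}}_I$ put $$\hat g_{w_1,w_2,w_3}(z)=\sum_{n\ge 0}z^n\sum_{k=0}^n\sum_{j=0}^k(w_2^j-w_1^j)(w_3^{k-j}-w_1^{k-j})(w_3^{n-k}-w_2^{n-k})\,b_jb_{k-j}b_{n-k},$$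 and for $r\in(0,1)$ define the *slice 3-diameter* $$\hat d_3(f(r\mathbb{B}))=\sup_{I\in\mathbb{S}}\ \max_{w_1,w_2,w_3\in\overline{\mathbb{B}}_I}\ \max_{z\in r\overline{\mathbb{B}}}\big|\hat g_{w_1,w_2,w_3}(z)\big|^{1/3}.$$ Let $d_3(\mathbb{B})=\sup_{w_1,w_2,w_3\in\mathbb{B}}\big(|w_2-w_1||w_3-w_1||w_3-w_2|\big)^{1/3}$ be the 3-diameter of $\mathbb{B}$. **Theorem.** Let $f$ be a slice regular function on $\mathbb{B}$ and, for $r\in(0,1)$, let $$\hat\varphi_3(r)=\frac{\hat d_3(f(r\mathbb{B}))}{d_3(\mathbb{B})\,r}.$$ Then $\hat\varphi_3$ is strictly increasing on $(0,1)$ if and only if $f$ is neither constant nor affine, that is, if and only if there are no $a,b\in\mathbb{H}$ with $f(q)=a+qb$ for all $q\in\mathbb{B}$. The same holds if, in the definition of $\hat d_3(f(r\mathbb{B}))$, the point $z$ is restricted to the disc $r\overline{\mathbb{B}}_I$ of the plane $L_I$ containing $w_1,w_2,w_3$. -/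

import Mathlib

open scoped Quaternion

noncomputable section

namespace SliceRegular

/-- The sphere of imaginary units of the quaternions. -/
def imagUnits : Set ℍ[ℝ] := {I | I * I = -1}

/-- The complex plane `L_I = ℝ + ℝ I` spanned by `1` and `I`. -/
def plane (I : ℍ[ℝ]) : Set ℍ[ℝ] := {q | ∃ x y : ℝ, q = (x : ℍ[ℝ]) + (y : ℍ[ℝ]) * I}

/-- Slice regularity on the open unit ball: for every imaginary unit `I`, the function
`(x, y) ↦ f (x + y I)` has continuous partial derivatives on the open unit disc and satisfies the
Cauchy-Riemann equation `(1/2) (∂/∂x + I ∂/∂y) f (x + y I) = 0` there. -/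
def IsSliceRegular (f : ℍ[ℝ] → ℍ[ℝ]) : Prop :=
  ∀ I ∈ imagUnits,
    ContDiffOn ℝ 1 (fun p : ℝ × ℝ => f ((p.1 : ℍ[ℝ]) + (p.2 : ℍ[ℝ]) * I))
      {p : ℝ × ℝ | (p.1 : ℍ[ℝ]) + (p.2 : ℍ[ℝ]) * I ∈ Metric.ball (0 : ℍ[ℝ]) 1} ∧
    ∀ x y : ℝ, (x : ℍ[ℝ]) + (y : ℍ[ℝ]) * I ∈ Metric.ball (0 : ℍ[ℝ]) 1 →
      (1 / 2 : ℝ) • (deriv (fun s : ℝ => f ((s : ℍ[ℝ]) + (y : ℍ[ℝ]) * I)) x +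
        I * deriv (fun t : ℝ => f ((x : ℍ[ℝ]) + (t : ℍ[ℝ]) * I)) y) = 0

/-- The power series coefficients `a_n = (1/n!) ∂ⁿf/∂xⁿ (0)` of a slice regular function
`f q = ∑ qⁿ a_n`; the derivatives are taken along the real axis. -/
def coeff (f : ℍ[ℝ] → ℍ[ℝ]) (n : ℕ) : ℍ[ℝ] :=
  ((n.factorial : ℝ)⁻¹) • iteratedDeriv n (fun x : ℝ => f (x : ℍ[ℝ])) 0

/-- The index `N` of the first non-vanishing coefficient (`0` if they all vanish). -/
def firstIndex (f : ℍ[ℝ] → ℍ[ℝ]) : ℕ := sInf {n : ℕ | coeff f n ≠ 0}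

/-- The normalized coefficients `b_n = a_n a_N⁻¹ |a_N|`, where `a_N` is the first non-vanishing
coefficient (they are all `0` if `f = 0`). -/
def normCoeff (f : ℍ[ℝ] → ℍ[ℝ]) (n : ℕ) : ℍ[ℝ] :=
  coeff f n * (coeff f (firstIndex f))⁻¹ * ((‖coeff f (firstIndex f)‖ : ℝ) : ℍ[ℝ])

/-- The function `ĝ_{w₁,w₂,w₃}(z)`. -/
def gHat (f : ℍ[ℝ] → ℍ[ℝ]) (w₁ w₂ w₃ z : ℍ[ℝ]) : ℍ[ℝ] :=
  ∑' n : ℕ, z ^ n * ∑ k ∈ Finset.range (n + 1), ∑ j ∈ Finset.range (k + 1),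
    (w₂ ^ j - w₁ ^ j) * (w₃ ^ (k - j) - w₁ ^ (k - j)) * (w₃ ^ (n - k) - w₂ ^ (n - k)) *
      normCoeff f j * normCoeff f (k - j) * normCoeff f (n - k)

/-- The slice `3`-diameter of `f (r𝔹)`: the supremum of `|ĝ_{w₁,w₂,w₃}(z)|^{1/3}` over all
imaginary units `I`, all `w₁, w₂, w₃` in the closed unit disc of `L_I`, and all quaternions `z`
with `|z| ≤ r`. -/
def sliceDiam3 (f : ℍ[ℝ] → ℍ[ℝ]) (r : ℝ) : ℝ :=
  sSup {d : ℝ | ∃ I ∈ imagUnits,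
    ∃ w₁ ∈ plane I ∩ Metric.closedBall 0 1, ∃ w₂ ∈ plane I ∩ Metric.closedBall 0 1,
    ∃ w₃ ∈ plane I ∩ Metric.closedBall 0 1, ∃ z ∈ Metric.closedBall (0 : ℍ[ℝ]) r,
      d = ‖gHat f w₁ w₂ w₃ z‖ ^ (1 / 3 : ℝ)}

/-- The variant of the slice `3`-diameter of `f (r𝔹)` in which `z` runs only over the closed disc
of radius `r` of the same plane `L_I` that contains `w₁, w₂, w₃`. -/
def planeDiam3 (f : ℍ[ℝ] → ℍ[ℝ]) (r : ℝ) : ℝ :=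
  sSup {d : ℝ | ∃ I ∈ imagUnits,
    ∃ w₁ ∈ plane I ∩ Metric.closedBall 0 1, ∃ w₂ ∈ plane I ∩ Metric.closedBall 0 1,
    ∃ w₃ ∈ plane I ∩ Metric.closedBall 0 1, ∃ z ∈ plane I ∩ Metric.closedBall (0 : ℍ[ℝ]) r,
      d = ‖gHat f w₁ w₂ w₃ z‖ ^ (1 / 3 : ℝ)}

/-- The `n`-diameter of a (bounded) set of quaternions:
`sup (∏_{j < k} |w_k - w_j|)^{2/(n(n-1))}` over all `w_1, …, w_n` in the set. -/
def nDiam (n : ℕ) (E : Set ℍ[ℝ]) : ℝ :=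
  sSup {d : ℝ | ∃ w : Fin n → ℍ[ℝ], (∀ i, w i ∈ E) ∧
    d = (∏ j : Fin n, ∏ k ∈ Finset.Ioi j, ‖w k - w j‖) ^ (2 / ((n : ℝ) * ((n : ℝ) - 1)))}

/-- `f` is constant or affine on the unit ball: `f q = a + q b` (constant if `b = 0`). -/
def IsAffineOnBall (f : ℍ[ℝ] → ℍ[ℝ]) : Prop :=
  ∃ a b : ℍ[ℝ], ∀ q ∈ Metric.ball (0 : ℍ[ℝ]) 1, f q = a + q * b

end SliceRegular

end

/-! Every triple of exponents summing to less than 3 contains a 0, which kills its term, so `ĝ(z) =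
z³ h(z)` with `h(0) = V b₁³`, where `V` is the Vandermonde product of `w₁, w₂, w₃` and `|V| ≤ 3√3`.
If `f` is affine, `h` is constant in `z` and the quotient cannot increase strictly.

Suppose the quotient does not increase from `r` to `s > r`. By the maximum principle on each slice,
the supremum of `|h|` over all parameters with `|z| ≤ s` is already attained at some `|z| ≤ r`. At
such an interior maximum the value is at most `|h(0)|`, so `|h| ≤ 3√3 |b₁|³` for all parameters
(`ConvergesOnBall.le_norm_coeff_zero`, `norm_vandermonde_three_le`).

This bound is impossible when some `bₙ ≠ 0` with `n ≥ 2` (`exists_norm_hCoeff_gt`). Let `m` be the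
least such `n`. If `b₁ = 0`, the bound forces `h = 0`, but the coefficient of `z^(3m)` in `ĝ` is a
Vandermonde product of m-th powers times `b_m³`. If `b₁ ≠ 0`, divide by `b₁³` on the right and
project to `ℂ`: the constant term becomes `V`, and a Borel–Carathéodory estimate bounds the
coefficient of `z^(m-1)` by a constant times `3√3 - |V|`. At the cube roots of unity this defect
vanishes to second order, so the coefficient, a polynomial in `w₁, w₂, w₃`, vanishes there to first
order. The resulting linear relations, for all slices and both orientations of the triangle, give
`b_m b₁ + b₁ b_m = 0` and `b_m b₁² + b₁² b_m = 0`. The first makes `b_m` commute with `b₁²`, so the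
second yields `b_m = 0`. -/

noncomputable section

namespace SliceRegular

/-! ### Vector-valued power series on the unit disc -/

section PowerSeries

variable {𝕜 E : Type*} [RCLike 𝕜] [NormedAddCommGroup E] [NormedSpace 𝕜 E]

theorem hasFPowerSeriesOnBall_of_hasSum {a : ℕ → E} {f : 𝕜 → E}
    (h : ∀ z : 𝕜, ‖z‖ < 1 → HasSum (fun n => z ^ n • a n) (f z)) :
    HasFPowerSeriesOnBall f
      (fun n => ContinuousMultilinearMap.mkPiRing 𝕜 (Fin n) (a n)) 0 1 where
  r_le := by
    refine ENNReal.le_of_forall_nnreal_lt fun ρ hρ => ?_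
    have hρ' : (ρ : ℝ) < 1 := by exact_mod_cast hρ
    refine FormalMultilinearSeries.le_radius_of_tendsto _ (l := 0) ?_
    have := (h ((ρ : ℝ) : 𝕜) (by simpa using hρ')).summable.tendsto_atTop_zero.norm
    simpa [norm_smul, mul_comm] using this
  r_pos := one_pos
  hasSum := by
    intro y hy
    have hy' : ‖y‖ < 1 := by
      simpa [Metric.mem_eball, edist_zero_right, enorm_eq_nnnorm, ← NNReal.coe_lt_coe] using hy
    simpa using h y hy'

theorem iteratedDeriv_of_hasSum [CompleteSpace E] {a : ℕ → E} {f : 𝕜 → E}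
    (h : ∀ z : 𝕜, ‖z‖ < 1 → HasSum (fun n => z ^ n • a n) (f z)) (n : ℕ) :
    iteratedDeriv n f 0 = (n.factorial : 𝕜) • a n := by
  have := (hasFPowerSeriesOnBall_of_hasSum h).factorial_smul 1 n
  rw [iteratedFDeriv_apply_eq_iteratedDeriv_mul_prod, Finset.prod_const_one, one_smul] at this
  rw [← this]
  simp [← Nat.cast_smul_eq_nsmul 𝕜]

theorem differentiableOn_of_hasSum [CompleteSpace E] {a : ℕ → E} {f : 𝕜 → E}
    (h : ∀ z : 𝕜, ‖z‖ < 1 → HasSum (fun n => z ^ n • a n) (f z)) :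
    DifferentiableOn 𝕜 f (Metric.ball 0 1) := by
  have := (hasFPowerSeriesOnBall_of_hasSum h).differentiableOn
  rwa [← ENNReal.ofReal_one, Metric.eball_ofReal] at this

theorem summable_norm_mul_pow_of_hasSum {a : ℕ → E} {f : 𝕜 → E}
    (h : ∀ z : 𝕜, ‖z‖ < 1 → HasSum (fun n => z ^ n • a n) (f z)) {ρ : ℝ} (h0 : 0 ≤ ρ)
    (h1 : ρ < 1) : Summable fun n => ‖a n‖ * ρ ^ n := by
  lift ρ to NNReal using h0
  have hr := (hasFPowerSeriesOnBall_of_hasSum h).r_le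
  have := FormalMultilinearSeries.summable_norm_mul_pow _ (r := ρ)
    (lt_of_lt_of_le (by exact_mod_cast h1) hr)
  simpa using this

end PowerSeries

/-! ### Complex slices of the quaternions -/

/-- The `ℝ`-linear embedding `x + i y ↦ x + y I` of `ℂ` onto the plane `L_I`. -/
def sliceEmb (I : ℍ[ℝ]) (z : ℂ) : ℍ[ℝ] := (z.re : ℍ[ℝ]) + (z.im : ℍ[ℝ]) * I

theorem sliceEmb_eq_lift {I : ℍ[ℝ]} (hI : I ∈ imagUnits) (z : ℂ) :
    sliceEmb I z = Complex.liftAux I hI z := by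
  exact congrArg (_ + ·) (Quaternion.coe_mul_eq_smul _ _)

theorem sliceEmb_mul {I : ℍ[ℝ]} (hI : I ∈ imagUnits) (z w : ℂ) :
    sliceEmb I (z * w) = sliceEmb I z * sliceEmb I w := by
  simp only [sliceEmb_eq_lift hI, map_mul]

theorem sliceEmb_pow {I : ℍ[ℝ]} (hI : I ∈ imagUnits) (z : ℂ) (n : ℕ) :
    sliceEmb I (z ^ n) = sliceEmb I z ^ n := by
  simp only [sliceEmb_eq_lift hI, map_pow]

theorem sliceEmb_sub (I : ℍ[ℝ]) (z w : ℂ) :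
    sliceEmb I (z - w) = sliceEmb I z - sliceEmb I w := by
  simp [sliceEmb, sub_mul]; abel

@[simp] theorem sliceEmb_zero (I : ℍ[ℝ]) : sliceEmb I 0 = 0 := by simp [sliceEmb]

@[simp] theorem sliceEmb_ofReal (I : ℍ[ℝ]) (x : ℝ) : sliceEmb I x = x := by simp [sliceEmb]

theorem mem_imagUnits_iff {I : ℍ[ℝ]} :
    I ∈ imagUnits ↔ I.re = 0 ∧ I.imI ^ 2 + I.imJ ^ 2 + I.imK ^ 2 = 1 := by
  simp only [imagUnits, Set.mem_ofPred_eq, Quaternion.ext_iff, Quaternion.re_mul,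
    Quaternion.imI_mul, Quaternion.imJ_mul, Quaternion.imK_mul, Quaternion.re_neg,
    Quaternion.imI_neg, Quaternion.imJ_neg, Quaternion.imK_neg, Quaternion.re_one,
    Quaternion.imI_one, Quaternion.imJ_one, Quaternion.imK_one]
  constructor
  · rintro ⟨h1, h2, h3, h4⟩
    have hre : I.re = 0 := by
      by_contra h
      have e2 : I.imI = 0 := by
        have : I.re * I.imI = 0 := by linarith
        simpa [h] using this
      have e3 : I.imJ = 0 := by
        have : I.re * I.imJ = 0 := by linarith
        simpa [h] using this
      have e4 : I.imK = 0 := by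
        have : I.re * I.imK = 0 := by linarith
        simpa [h] using this
      rw [e2, e3, e4] at h1
      nlinarith [sq_nonneg I.re]
    refine ⟨hre, ?_⟩
    rw [hre] at h1
    linarith
  · rintro ⟨h1, h2⟩
    rw [h1]
    refine ⟨by linarith, by ring, by ring, by ring⟩

theorem norm_sq_eq (q : ℍ[ℝ]) :
    ‖q‖ ^ 2 = q.re ^ 2 + q.imI ^ 2 + q.imJ ^ 2 + q.imK ^ 2 := by
  rw [sq, ← Quaternion.normSq_eq_norm_mul_self, Quaternion.normSq_def']

theorem norm_sliceEmb {I : ℍ[ℝ]} (hI : I ∈ imagUnits) (z : ℂ) : ‖sliceEmb I z‖ = ‖z‖ := by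
  obtain ⟨h1, h2⟩ := mem_imagUnits_iff.1 hI
  rw [← sq_eq_sq₀ (norm_nonneg _) (norm_nonneg _), norm_sq_eq, ← Complex.normSq_eq_norm_sq,
    Complex.normSq_apply, sliceEmb, Quaternion.coe_mul_eq_smul]
  simp [h1]
  linear_combination z.im ^ 2 * h2

theorem norm_of_mem_imagUnits {I : ℍ[ℝ]} (hI : I ∈ imagUnits) : ‖I‖ = 1 := by
  have := norm_sliceEmb hI Complex.I
  simpa [sliceEmb] using this

theorem mem_plane_iff {I q : ℍ[ℝ]} : q ∈ plane I ↔ ∃ z : ℂ, sliceEmb I z = q := by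
  constructor
  · rintro ⟨x, y, rfl⟩
    exact ⟨⟨x, y⟩, rfl⟩
  · rintro ⟨z, rfl⟩
    exact ⟨z.re, z.im, rfl⟩

theorem imagUnits_nonempty : imagUnits.Nonempty :=
  ⟨⟨0, 1, 0, 0⟩, mem_imagUnits_iff.2 (by norm_num)⟩

theorem exists_mem_plane (q : ℍ[ℝ]) : ∃ I ∈ imagUnits, ∃ z : ℂ, sliceEmb I z = q := by
  by_cases h : q.im = 0
  · obtain ⟨I, hI⟩ := imagUnits_nonempty
    refine ⟨I, hI, (q.re : ℂ), ?_⟩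
    rw [sliceEmb_ofReal]
    conv_rhs => rw [← Quaternion.re_add_im q, h, add_zero]
  · have hn : ‖q.im‖ ≠ 0 := norm_ne_zero_iff.2 h
    have hsq := norm_sq_eq q.im
    refine ⟨‖q.im‖⁻¹ • q.im, mem_imagUnits_iff.2 ⟨by simp, ?_⟩, ⟨q.re, ‖q.im‖⟩, ?_⟩
    · simp only [Quaternion.imI_smul, Quaternion.imJ_smul, Quaternion.imK_smul, smul_eq_mul]
      simp only [Quaternion.re_im] at hsq
      field_simp
      linarith
    · rw [sliceEmb, Quaternion.coe_mul_eq_smul, smul_smul, mul_inv_cancel₀ hn, one_smul]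
      exact Quaternion.re_add_im q

theorem continuous_sliceEmb : Continuous fun p : ℍ[ℝ] × ℂ => sliceEmb p.1 p.2 := by
  unfold sliceEmb
  have h1 : Continuous fun p : ℍ[ℝ] × ℂ => ((p.2.re : ℝ) : ℍ[ℝ]) :=
    Quaternion.continuous_coe.comp (Complex.continuous_re.comp continuous_snd)
  have h2 : Continuous fun p : ℍ[ℝ] × ℂ => ((p.2.im : ℝ) : ℍ[ℝ]) :=
    Quaternion.continuous_coe.comp (Complex.continuous_im.comp continuous_snd)
  exact h1.add (h2.mul continuous_fst)

/-- The projection of `ℍ` onto `L_I ≃ ℂ`, which is `ℂ`-linear for left multiplication. -/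
def sliceProj (I : ℍ[ℝ]) : ℍ[ℝ] →L[ℝ] ℂ :=
  LinearMap.toContinuousLinearMap
    { toFun := fun q => ⟨q.re, -(I * q).re⟩
      map_add' := fun p q => by
        apply Complex.ext <;> simp [mul_add]; ring
      map_smul' := fun c q => by
        apply Complex.ext <;> simp; ring }

theorem sliceProj_apply (I q : ℍ[ℝ]) : sliceProj I q = ⟨q.re, -(I * q).re⟩ := rfl

theorem sliceProj_sliceEmb_mul {I : ℍ[ℝ]} (hI : I ∈ imagUnits) (z : ℂ) (q : ℍ[ℝ]) :
    sliceProj I (sliceEmb I z * q) = z * sliceProj I q := by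
  have h : I * (I * q) = -q := by
    rw [← mul_assoc, show I * I = -1 from hI, neg_one_mul]
  rw [sliceProj_apply, sliceProj_apply, sliceEmb, Quaternion.coe_mul_eq_smul, add_mul, mul_add,
    smul_mul_assoc, mul_smul_comm, h, Quaternion.coe_mul_eq_smul, mul_smul_comm]
  apply Complex.ext <;> simp <;> ring

theorem norm_sliceProj_le {I : ℍ[ℝ]} (hI : I ∈ imagUnits) (q : ℍ[ℝ]) :
    ‖sliceProj I q‖ ≤ ‖q‖ := by
  by_cases h : sliceProj I q = 0
  · simp [h]
  have hn : ‖sliceProj I q‖ ≠ 0 := norm_ne_zero_iff.2 h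
  -- Rotating by the conjugate makes the projection real and nonnegative, so it is bounded by the
  -- real part of a quaternion of known norm.
  set u : ℂ := (starRingEnd ℂ) (sliceProj I q) with hu
  have h1 : (sliceProj I (sliceEmb I u * q)).re = ‖sliceProj I q‖ ^ 2 := by
    rw [sliceProj_sliceEmb_mul hI, hu, mul_comm, Complex.mul_conj, Complex.normSq_eq_norm_sq]
    exact Complex.ofReal_re _
  have h2 : (sliceProj I (sliceEmb I u * q)).re ≤ ‖sliceEmb I u * q‖ := by
    rw [sliceProj_apply]
    refine le_trans (le_abs_self _) (abs_le_of_sq_le_sq ?_ (norm_nonneg _))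
    rw [norm_sq_eq]
    nlinarith [sq_nonneg (sliceEmb I u * q).imI, sq_nonneg (sliceEmb I u * q).imJ,
      sq_nonneg (sliceEmb I u * q).imK]
  rw [norm_mul, norm_sliceEmb hI, hu, RCLike.norm_conj, h1, sq] at h2
  exact le_of_mul_le_mul_left h2 (lt_of_le_of_ne (norm_nonneg _) hn.symm)

/-- The units i, j, k already read off all four coordinates. This turns complex identities known on
every slice into a quaternionic one. -/
theorem eq_zero_of_sliceProj_eq_zero {q : ℍ[ℝ]} (h : ∀ I ∈ imagUnits, sliceProj I q = 0) :
    q = 0 := by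
  have h' : ∀ I ∈ imagUnits, q.re = 0 ∧
      I.re * q.re - I.imI * q.imI - I.imJ * q.imJ - I.imK * q.imK = 0 := fun I hI => by
    have := h I hI
    rw [sliceProj_apply, Complex.ext_iff] at this
    simpa only [Complex.zero_re, Complex.zero_im, neg_eq_zero, Quaternion.re_mul] using this
  have h1 := h' ⟨0, 1, 0, 0⟩ (mem_imagUnits_iff.2 (by norm_num))
  have h2 := h' ⟨0, 0, 1, 0⟩ (mem_imagUnits_iff.2 (by norm_num))
  have h3 := h' ⟨0, 0, 0, 1⟩ (mem_imagUnits_iff.2 (by norm_num))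
  norm_num at h1 h2 h3
  exact Quaternion.ext _ _ h1.1 h1.2 h2.2 h3.2

/-! ### Power series expansion of slice regular functions -/

/-- The complex structure on `ℍ` given by left multiplication with elements of `L_I`. -/
abbrev sliceModule {I : ℍ[ℝ]} (hI : I ∈ imagUnits) : Module ℂ ℍ[ℝ] :=
  Module.compHom ℍ[ℝ] (Complex.liftAux I hI).toRingHom

/-- The complex normed space structure on `ℍ` given by left multiplication with elements of
`L_I`. -/
abbrev sliceNormedSpace {I : ℍ[ℝ]} (hI : I ∈ imagUnits) : NormedSpace ℂ ℍ[ℝ] :=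
  { sliceModule hI with
    norm_smul_le := fun z q => by
      change ‖Complex.liftAux I hI z * q‖ ≤ _
      rw [norm_mul, ← sliceEmb_eq_lift hI, norm_sliceEmb hI] }

/-- Left multiplication by `L_I` makes `ℍ` a complex Banach space. The Cauchy–Riemann equation says
exactly that the real derivative is complex linear, so the holomorphic Taylor expansion applies. -/
theorem hasSum_slice_of_cauchyRiemann {I : ℍ[ℝ]} (hI : I ∈ imagUnits) {F : ℂ → ℍ[ℝ]}
    (hd : ∀ z ∈ Metric.ball (0 : ℂ) 1, DifferentiableAt ℝ F z)
    (hcr : ∀ z ∈ Metric.ball (0 : ℂ) 1, fderiv ℝ F z Complex.I = I * fderiv ℝ F z 1) :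
    ∃ a : ℕ → ℍ[ℝ], ∀ z : ℂ, ‖z‖ < 1 → HasSum (fun n => sliceEmb I (z ^ n) * a n) (F z) := by
  let _ := sliceNormedSpace hI
  have hsm : ∀ (z : ℂ) (q : ℍ[ℝ]), z • q = sliceEmb I z * q := fun z q => by
    rw [sliceEmb_eq_lift hI]; rfl
  have : IsScalarTower ℝ ℂ ℍ[ℝ] := ⟨fun x z q => by
    rw [hsm, hsm, ← smul_mul_assoc]
    congr 1
    rw [sliceEmb_eq_lift hI, sliceEmb_eq_lift hI, map_smul]⟩
  have hdiff : DifferentiableOn ℂ F (Metric.ball 0 1) := by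
    intro z hz
    have h1 := (hd z hz).hasFDerivAt
    refine DifferentiableAt.differentiableWithinAt ?_
    refine (differentiableAt_iff_restrictScalars ℝ (hd z hz)).2
      ⟨(ContinuousLinearMap.id ℂ ℂ).smulRight (fderiv ℝ F z 1), ?_⟩
    refine ContinuousLinearMap.ext fun w => ?_
    have hw : w = w.re • (1 : ℂ) + w.im • Complex.I := by
      apply Complex.ext <;> simp
    have h2 : fderiv ℝ F z w = w.re • fderiv ℝ F z 1 + w.im • (I * fderiv ℝ F z 1) := by
      rw [← hcr z hz]
      conv_lhs => rw [hw]
      rw [map_add, map_smul, map_smul]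
    rw [h2]
    simp [hsm, sliceEmb, add_mul, Quaternion.coe_mul_eq_smul]
  refine ⟨fun n => ((n.factorial : ℂ)⁻¹) • iteratedDeriv n F 0, fun z hz => ?_⟩
  have := Complex.hasSum_taylorSeries_on_ball (r := 1) (c := 0) (f := F) hdiff (z := z)
    (by simpa using hz)
  simp only [sub_zero] at this
  refine this.congr_fun ?_
  intro n
  rw [← hsm, smul_comm]

theorem IsSliceRegular.hasSum_slice_aux {f : ℍ[ℝ] → ℍ[ℝ]} (hf : IsSliceRegular f) {I : ℍ[ℝ]}
    (hI : I ∈ imagUnits) :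
    ∃ a : ℕ → ℍ[ℝ], ∀ z : ℂ, ‖z‖ < 1 →
      HasSum (fun n => sliceEmb I (z ^ n) * a n) (f (sliceEmb I z)) := by
  obtain ⟨hC, hcr⟩ := hf I hI
  set U : Set (ℝ × ℝ) := {p : ℝ × ℝ | (p.1 : ℍ[ℝ]) + (p.2 : ℍ[ℝ]) * I ∈ Metric.ball (0 : ℍ[ℝ]) 1}
  set g : ℝ × ℝ → ℍ[ℝ] := fun p => f ((p.1 : ℍ[ℝ]) + (p.2 : ℍ[ℝ]) * I)
  have hcont : Continuous fun p : ℝ × ℝ => (p.1 : ℍ[ℝ]) + (p.2 : ℍ[ℝ]) * I :=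
    (Quaternion.continuous_coe.comp continuous_fst).add
      ((Quaternion.continuous_coe.comp continuous_snd).mul continuous_const)
  have hU : IsOpen U := Metric.isOpen_ball.preimage hcont
  have hmem : ∀ z ∈ Metric.ball (0 : ℂ) 1, Complex.equivRealProdCLM z ∈ U := fun z hz => by
    change sliceEmb I z ∈ Metric.ball (0 : ℍ[ℝ]) 1
    rw [mem_ball_zero_iff, norm_sliceEmb hI]
    exact mem_ball_zero_iff.1 hz
  have hg : ∀ z ∈ Metric.ball (0 : ℂ) 1, DifferentiableAt ℝ g (Complex.equivRealProdCLM z) :=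
    fun z hz => (hC.differentiableOn one_ne_zero).differentiableAt (hU.mem_nhds (hmem z hz))
  have hF : ∀ z ∈ Metric.ball (0 : ℂ) 1, HasFDerivAt (fun z => f (sliceEmb I z))
      ((fderiv ℝ g (Complex.equivRealProdCLM z)).comp
        (Complex.equivRealProdCLM : ℂ →L[ℝ] ℝ × ℝ)) z := fun z hz =>
    (hg z hz).hasFDerivAt.comp z Complex.equivRealProdCLM.hasFDerivAt
  refine hasSum_slice_of_cauchyRiemann hI (fun z hz => (hF z hz).differentiableAt) fun z hz => ?_
  rw [(hF z hz).fderiv]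
  set D := fderiv ℝ g (Complex.equivRealProdCLM z) with hD
  have hx : deriv (fun s : ℝ => f ((s : ℍ[ℝ]) + (z.im : ℍ[ℝ]) * I)) z.re = D (1, 0) := by
    have h2 : HasDerivAt (fun s : ℝ => (s, z.im)) ((1 : ℝ), (0 : ℝ)) z.re :=
      (hasDerivAt_id z.re).prodMk (hasDerivAt_const z.re z.im)
    exact (HasFDerivAt.comp_hasDerivAt z.re (hg z hz).hasFDerivAt h2).deriv
  have hy : deriv (fun t : ℝ => f ((z.re : ℍ[ℝ]) + (t : ℍ[ℝ]) * I)) z.im = D (0, 1) := by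
    have h2 : HasDerivAt (fun t : ℝ => (z.re, t)) ((0 : ℝ), (1 : ℝ)) z.im :=
      (hasDerivAt_const z.im z.re).prodMk (hasDerivAt_id z.im)
    exact (HasFDerivAt.comp_hasDerivAt z.im (hg z hz).hasFDerivAt h2).deriv
  have h := hcr z.re z.im (hmem z hz)
  rw [hx, hy, smul_eq_zero_iff_right (by norm_num)] at h
  -- Multiplying `∂ₓf + I ∂ᵧf = 0` by `I` on the left gives `∂ᵧf = I ∂ₓf`.
  have h' := congrArg (I * ·) h
  simp only [mul_add, ← mul_assoc, show I * I = -1 from hI, mul_zero, neg_one_mul] at h'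
  simpa using (add_neg_eq_zero.1 h').symm

theorem coeff_eq_of_hasSum {f : ℍ[ℝ] → ℍ[ℝ]} {a : ℕ → ℍ[ℝ]}
    (h : ∀ x : ℝ, ‖x‖ < 1 → HasSum (fun n => x ^ n • a n) (f (x : ℍ[ℝ]))) (n : ℕ) :
    coeff f n = a n := by
  rw [coeff, iteratedDeriv_of_hasSum h n, smul_smul, inv_mul_cancel₀ (by positivity), one_smul]

/-- All slices share the real axis, which determines the coefficients, so the expansion does not
depend on `I`. -/
theorem IsSliceRegular.hasSum_slice {f : ℍ[ℝ] → ℍ[ℝ]} (hf : IsSliceRegular f) {I : ℍ[ℝ]}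
    (hI : I ∈ imagUnits) {z : ℂ} (hz : ‖z‖ < 1) :
    HasSum (fun n => sliceEmb I (z ^ n) * coeff f n) (f (sliceEmb I z)) := by
  obtain ⟨a, ha⟩ := hf.hasSum_slice_aux hI
  have hc : ∀ n, coeff f n = a n := coeff_eq_of_hasSum fun x hx => by
    have := ha (x : ℂ) (by simpa using hx)
    rw [sliceEmb_ofReal] at this
    refine this.congr_fun fun n => ?_
    rw [← Complex.ofReal_pow, sliceEmb_ofReal, Quaternion.coe_mul_eq_smul]
  simpa only [hc] using ha z hz

theorem IsSliceRegular.hasSum_real {f : ℍ[ℝ] → ℍ[ℝ]} (hf : IsSliceRegular f) {x : ℝ}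
    (hx : ‖x‖ < 1) : HasSum (fun n => x ^ n • coeff f n) (f (x : ℍ[ℝ])) := by
  obtain ⟨I, hI⟩ := imagUnits_nonempty
  have := hf.hasSum_slice hI (z := (x : ℂ)) (by simpa using hx)
  rw [sliceEmb_ofReal] at this
  refine this.congr_fun fun n => ?_
  rw [← Complex.ofReal_pow, sliceEmb_ofReal, Quaternion.coe_mul_eq_smul]

theorem IsSliceRegular.summable_norm_coeff {f : ℍ[ℝ] → ℍ[ℝ]} (hf : IsSliceRegular f) {ρ : ℝ}
    (h0 : 0 ≤ ρ) (h1 : ρ < 1) : Summable fun n => ‖coeff f n‖ * ρ ^ n :=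
  summable_norm_mul_pow_of_hasSum (f := fun x : ℝ => f x) (fun _ hx => hf.hasSum_real hx) h0 h1

theorem IsSliceRegular.isAffineOnBall_iff {f : ℍ[ℝ] → ℍ[ℝ]} (hf : IsSliceRegular f) :
    IsAffineOnBall f ↔ ∀ n, 2 ≤ n → coeff f n = 0 := by
  constructor
  · rintro ⟨a, b, hab⟩ n hn
    have : coeff f n = (fun n => if n = 0 then a else if n = 1 then b else 0) n := by
      refine coeff_eq_of_hasSum
        (a := fun n => if n = 0 then a else if n = 1 then b else 0) (fun x hx => ?_) n
      rw [hab _ (by simpa using hx), Quaternion.coe_mul_eq_smul]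
      have h2 := hasSum_sum_of_ne_finset_zero (L := .unconditional ℕ) (s := Finset.range 2)
        (f := fun n => x ^ n • (if n = 0 then a else if n = 1 then b else 0)) fun n hn => by
          have : 2 ≤ n := by simpa [Nat.succ_le_iff] using hn
          rw [if_neg (by omega), if_neg (by omega), smul_zero]
      simpa [Finset.sum_range_succ] using h2
    rw [this]
    simp only
    rw [if_neg (by omega), if_neg (by omega)]
  · intro h
    refine ⟨coeff f 0, coeff f 1, fun q hq => ?_⟩
    obtain ⟨I, hI, z, rfl⟩ := exists_mem_plane q
    rw [mem_ball_zero_iff, norm_sliceEmb hI] at hq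
    refine (hf.hasSum_slice hI hq).unique ?_
    have h2 := hasSum_sum_of_ne_finset_zero (L := .unconditional ℕ) (s := Finset.range 2)
      (f := fun n => sliceEmb I (z ^ n) * coeff f n) fun n hn => by
        rw [h n (by simpa [Nat.succ_le_iff] using hn), mul_zero]
    have h1 : sliceEmb I 1 = 1 := by simpa using sliceEmb_ofReal I 1
    simpa [Finset.sum_range_succ, h1] using h2

/-! ### Coefficients of `ĝ` -/

/-- The coefficients of the power series `ĝ` built from a sequence `b`. -/
def gCoeff (b : ℕ → ℍ[ℝ]) (w₁ w₂ w₃ : ℍ[ℝ]) (n : ℕ) : ℍ[ℝ] :=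
  ∑ k ∈ Finset.range (n + 1), ∑ j ∈ Finset.range (k + 1),
    (w₂ ^ j - w₁ ^ j) * (w₃ ^ (k - j) - w₁ ^ (k - j)) * (w₃ ^ (n - k) - w₂ ^ (n - k)) *
      b j * b (k - j) * b (n - k)

theorem gHat_eq_tsum (f : ℍ[ℝ] → ℍ[ℝ]) (w₁ w₂ w₃ z : ℍ[ℝ]) :
    gHat f w₁ w₂ w₃ z = ∑' n, z ^ n * gCoeff (normCoeff f) w₁ w₂ w₃ n := rfl

/-- A majorant of `‖gCoeff b w₁ w₂ w₃ n‖` for `w₁, w₂, w₃` in the closed unit ball. -/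
def gMajorant (b : ℕ → ℍ[ℝ]) (n : ℕ) : ℝ :=
  8 * ∑ k ∈ Finset.range (n + 1),
    (∑ j ∈ Finset.range (k + 1), ‖b j‖ * ‖b (k - j)‖) * ‖b (n - k)‖

theorem norm_pow_sub_pow_le {w w' : ℍ[ℝ]} (h : ‖w‖ ≤ 1) (h' : ‖w'‖ ≤ 1) (n : ℕ) :
    ‖w ^ n - w' ^ n‖ ≤ 2 := by
  refine (norm_sub_le _ _).trans ?_
  rw [norm_pow, norm_pow]
  linarith [pow_le_one₀ (n := n) (norm_nonneg w) h, pow_le_one₀ (n := n) (norm_nonneg w') h']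

theorem norm_gCoeff_le (b : ℕ → ℍ[ℝ]) {w₁ w₂ w₃ : ℍ[ℝ]} (h₁ : ‖w₁‖ ≤ 1) (h₂ : ‖w₂‖ ≤ 1)
    (h₃ : ‖w₃‖ ≤ 1) (n : ℕ) : ‖gCoeff b w₁ w₂ w₃ n‖ ≤ gMajorant b n := by
  rw [gMajorant, Finset.mul_sum]
  refine (norm_sum_le _ _).trans (Finset.sum_le_sum fun k _ => ?_)
  rw [Finset.sum_mul, Finset.mul_sum]
  refine (norm_sum_le _ _).trans (Finset.sum_le_sum fun j _ => ?_)
  simp only [norm_mul]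
  have : ‖w₂ ^ j - w₁ ^ j‖ * ‖w₃ ^ (k - j) - w₁ ^ (k - j)‖ * ‖w₃ ^ (n - k) - w₂ ^ (n - k)‖
      ≤ 2 * 2 * 2 := by
    gcongr <;> apply norm_pow_sub_pow_le <;> assumption
  calc _ ≤ 2 * 2 * 2 * ‖b j‖ * ‖b (k - j)‖ * ‖b (n - k)‖ := by gcongr
    _ = _ := by ring

theorem summable_gMajorant {b : ℕ → ℍ[ℝ]} {ρ : ℝ}
    (hb : Summable fun n => ‖b n‖ * ρ ^ n) : Summable fun n => gMajorant b n * ρ ^ n := by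
  have hb' : Summable fun n => ‖‖b n‖ * ρ ^ n‖ := hb.abs
  have h2 := summable_norm_sum_mul_range_of_summable_norm hb' hb'
  have h3 := summable_norm_sum_mul_range_of_summable_norm h2 hb'
  refine (h3.of_norm.mul_left 8).congr fun n => ?_
  rw [gMajorant, mul_assoc, Finset.sum_mul]
  congr 1
  refine Finset.sum_congr rfl fun k hk => ?_
  have hk' : k ≤ n := Nat.lt_succ_iff.1 (Finset.mem_range.1 hk)
  have : ∑ j ∈ Finset.range (k + 1), ‖b j‖ * ρ ^ j * (‖b (k - j)‖ * ρ ^ (k - j)) =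
      (∑ j ∈ Finset.range (k + 1), ‖b j‖ * ‖b (k - j)‖) * ρ ^ k := by
    rw [Finset.sum_mul]
    refine Finset.sum_congr rfl fun j hj => ?_
    have hj' : j ≤ k := Nat.lt_succ_iff.1 (Finset.mem_range.1 hj)
    rw [← Nat.add_sub_of_le hj', pow_add]
    simp only [add_tsub_cancel_left]
    ring
  rw [this]
  conv_rhs => rw [← Nat.add_sub_of_le hk', pow_add]
  simp only [add_tsub_cancel_left]
  ring

theorem sum_range_triple_eq_zero {A : Type*} [AddCommMonoid A] (T : ℕ → ℕ → ℕ → A) (n : ℕ)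
    (h : ∀ j l i, j + l + i = n → T j l i = 0) :
    ∑ k ∈ Finset.range (n + 1), ∑ j ∈ Finset.range (k + 1), T j (k - j) (n - k) = 0 := by
  refine Finset.sum_eq_zero fun k hk => Finset.sum_eq_zero fun j hj => h _ _ _ ?_
  simp only [Finset.mem_range] at hk hj
  omega

/-- Three indices, each at least `N`, with sum `3N` must all equal `N`. -/
theorem sum_range_triple_eq_single {A : Type*} [AddCommMonoid A] (T : ℕ → ℕ → ℕ → A) (N : ℕ)
    (h : ∀ j l i, j < N ∨ l < N ∨ i < N → T j l i = 0) :
    ∑ k ∈ Finset.range (3 * N + 1), ∑ j ∈ Finset.range (k + 1), T j (k - j) (3 * N - k) =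
      T N N N := by
  rw [Finset.sum_sigma', Finset.sum_eq_single ⟨2 * N, N⟩]
  · dsimp only
    congr 1 <;> omega
  · rintro ⟨k, j⟩ hkj hne
    simp only [Finset.mem_sigma, Finset.mem_range] at hkj
    refine h _ _ _ ?_
    by_contra! hcon
    refine hne ?_
    obtain rfl : j = N := by dsimp only at *; omega
    obtain rfl : k = 2 * j := by dsimp only at *; omega
    rfl
  · intro hn
    exact absurd (by simp only [Finset.mem_sigma, Finset.mem_range]; omega) hn

/-- Surviving indices are 1 or at least `m`. Three 1's sum to less than `m + 2`, and two indices at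
least `m` exceed it since `m ≥ 2`; so exactly one index is `m`. -/
theorem sum_range_triple_eq_three {A : Type*} [AddCommMonoid A] (T : ℕ → ℕ → ℕ → A) {m : ℕ}
    (hm : 2 ≤ m)
    (h : ∀ j l i, (j ≠ 1 ∧ j < m) ∨ (l ≠ 1 ∧ l < m) ∨ (i ≠ 1 ∧ i < m) → T j l i = 0) :
    ∑ k ∈ Finset.range (m + 2 + 1), ∑ j ∈ Finset.range (k + 1), T j (k - j) (m + 2 - k) =
      T m 1 1 + T 1 m 1 + T 1 1 m := by
  rw [Finset.sum_sigma', ← Finset.sum_subset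
    (s₁ := {(⟨m + 1, m⟩ : Σ _ : ℕ, ℕ), ⟨m + 1, 1⟩, ⟨2, 1⟩})]
  · rw [Finset.sum_insert, Finset.sum_insert, Finset.sum_singleton, ← add_assoc]
    · dsimp only
      rw [show m + 1 - m = 1 by omega, show m + 2 - (m + 1) = 1 by omega, show m + 1 - 1 = m by omega,
        show m + 2 - 2 = m by omega]
    · simp; omega
    · simp; omega
  · intro x hx
    simp only [Finset.mem_insert, Finset.mem_singleton] at hx
    rcases hx with rfl | rfl | rfl <;> simp only [Finset.mem_sigma, Finset.mem_range] <;> omega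
  · rintro ⟨k, j⟩ hkj hne
    simp only [Finset.mem_sigma, Finset.mem_range] at hkj
    refine h _ _ _ ?_
    by_contra! hcon
    simp only [Finset.mem_insert, Finset.mem_singleton, Sigma.mk.injEq, heq_eq_eq, not_or] at hne
    dsimp only at *
    omega

theorem gCoeff_eq_zero (b : ℕ → ℍ[ℝ]) (w₁ w₂ w₃ : ℍ[ℝ]) {n : ℕ} (hn : n < 3) :
    gCoeff b w₁ w₂ w₃ n = 0 :=
  sum_range_triple_eq_zero (fun j l i => (w₂ ^ j - w₁ ^ j) * (w₃ ^ l - w₁ ^ l) *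
    (w₃ ^ i - w₂ ^ i) * b j * b l * b i) n fun j l i h => by
      have : j = 0 ∨ l = 0 ∨ i = 0 := by omega
      rcases this with rfl | rfl | rfl <;> simp

theorem gCoeff_three_mul {b : ℕ → ℍ[ℝ]} (w₁ w₂ w₃ : ℍ[ℝ]) {N : ℕ}
    (hb : ∀ n, 1 ≤ n → n < N → b n = 0) :
    gCoeff b w₁ w₂ w₃ (3 * N) = (w₂ ^ N - w₁ ^ N) * (w₃ ^ N - w₁ ^ N) * (w₃ ^ N - w₂ ^ N) *
      b N * b N * b N :=
  sum_range_triple_eq_single (fun j l i => (w₂ ^ j - w₁ ^ j) * (w₃ ^ l - w₁ ^ l) *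
    (w₃ ^ i - w₂ ^ i) * b j * b l * b i) N fun j l i h => by
      have hz : ∀ n, n < N → n = 0 ∨ b n = 0 := fun n hn => by
        rcases Nat.eq_zero_or_pos n with h | h
        · exact Or.inl h
        · exact Or.inr (hb n h hn)
      rcases h with h | h | h <;> rcases hz _ h with h' | h' <;> simp [h']

theorem gCoeff_three (b : ℕ → ℍ[ℝ]) (w₁ w₂ w₃ : ℍ[ℝ]) :
    gCoeff b w₁ w₂ w₃ 3 = (w₂ - w₁) * (w₃ - w₁) * (w₃ - w₂) * b 1 * b 1 * b 1 := by
  simpa using gCoeff_three_mul (b := b) (N := 1) w₁ w₂ w₃ (fun n h1 h2 => by omega)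

theorem gCoeff_add_two {b : ℕ → ℍ[ℝ]} (w₁ w₂ w₃ : ℍ[ℝ]) {m : ℕ} (hm : 2 ≤ m)
    (hb : ∀ n, 2 ≤ n → n < m → b n = 0) :
    gCoeff b w₁ w₂ w₃ (m + 2) =
      (w₂ ^ m - w₁ ^ m) * (w₃ - w₁) * (w₃ - w₂) * b m * b 1 * b 1 +
      (w₂ - w₁) * (w₃ ^ m - w₁ ^ m) * (w₃ - w₂) * b 1 * b m * b 1 +
      (w₂ - w₁) * (w₃ - w₁) * (w₃ ^ m - w₂ ^ m) * b 1 * b 1 * b m := by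
  have := sum_range_triple_eq_three (fun j l i => (w₂ ^ j - w₁ ^ j) * (w₃ ^ l - w₁ ^ l) *
    (w₃ ^ i - w₂ ^ i) * b j * b l * b i) hm fun j l i h => by
      have hz : ∀ n, n ≠ 1 ∧ n < m → n = 0 ∨ b n = 0 := fun n hn => by
        rcases Nat.eq_zero_or_pos n with h | h
        · exact Or.inl h
        · exact Or.inr (hb n (by omega) hn.2)
      rcases h with h | h | h <;> rcases hz _ h with h' | h' <;> simp [h']
  simp only [pow_one] at this
  exact this

/-! ### Quaternionic power series and their complex projections -/

/-- The sum `∑ zⁿ cₙ` of a quaternionic power series with coefficients on the right. -/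
def powerSum (c : ℕ → ℍ[ℝ]) (z : ℍ[ℝ]) : ℍ[ℝ] := ∑' n, z ^ n * c n

/-- The power series with coefficients `c` converges absolutely in the open unit ball. -/
def ConvergesOnBall (c : ℕ → ℍ[ℝ]) : Prop :=
  ∀ ρ : ℝ, 0 ≤ ρ → ρ < 1 → Summable fun n => ‖c n‖ * ρ ^ n

theorem ConvergesOnBall.summable {c : ℕ → ℍ[ℝ]} (hc : ConvergesOnBall c) {z : ℍ[ℝ]}
    (hz : ‖z‖ < 1) : Summable fun n => z ^ n * c n := by
  refine Summable.of_norm_bounded (hc ‖z‖ (norm_nonneg z) hz) fun n => ?_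
  rw [norm_mul, norm_pow, mul_comm]

theorem ConvergesOnBall.shift {c : ℕ → ℍ[ℝ]} (hc : ConvergesOnBall c) (k : ℕ) :
    ConvergesOnBall fun n => c (n + k) := by
  intro ρ h0 h1
  rcases h0.eq_or_lt with rfl | h0'
  · refine summable_of_ne_finset_zero (s := {0}) fun n hn => ?_
    rw [zero_pow (by simpa using hn), mul_zero]
  · have := ((summable_nat_add_iff k).2 (hc ρ h0 h1)).mul_right (ρ ^ k)⁻¹
    refine this.congr fun n => ?_
    rw [pow_add]
    field_simp

theorem ConvergesOnBall.gCoeff {b : ℕ → ℍ[ℝ]} (hb : ConvergesOnBall b) {w₁ w₂ w₃ : ℍ[ℝ]}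
    (h₁ : ‖w₁‖ ≤ 1) (h₂ : ‖w₂‖ ≤ 1) (h₃ : ‖w₃‖ ≤ 1) :
    ConvergesOnBall (gCoeff b w₁ w₂ w₃) := fun ρ h0 h1 =>
  Summable.of_nonneg_of_le (fun n => by positivity)
    (fun n => mul_le_mul_of_nonneg_right (norm_gCoeff_le b h₁ h₂ h₃ n) (pow_nonneg h0 n))
    (summable_gMajorant (hb ρ h0 h1))

theorem powerSum_eq_pow_three_mul {c : ℕ → ℍ[ℝ]} (hc : ConvergesOnBall c)
    (h : ∀ n < 3, c n = 0) {z : ℍ[ℝ]} (hz : ‖z‖ < 1) :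
    powerSum c z = z ^ 3 * powerSum (fun n => c (n + 3)) z := by
  rw [powerSum, ← (hc.summable hz).sum_add_tsum_nat_add 3,
    Finset.sum_eq_zero fun n hn => by rw [h n (Finset.mem_range.1 hn), mul_zero], zero_add,
    powerSum, ← ((hc.shift 3).summable hz).tsum_mul_left]
  refine tsum_congr fun n => ?_
  rw [← mul_assoc, ← pow_add, add_comm 3 n]

theorem powerSum_zero (c : ℕ → ℍ[ℝ]) : powerSum c 0 = c 0 := by
  rw [powerSum, tsum_eq_single 0 fun n hn => by rw [zero_pow hn, zero_mul], pow_zero, one_mul]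

/-- Right multiplication by `v` commutes with left multiplication by powers of `z`, so after
normalizing on the right the projection is an ordinary complex power series. -/
theorem ConvergesOnBall.hasSum_sliceProj {c : ℕ → ℍ[ℝ]} (hc : ConvergesOnBall c) {J : ℍ[ℝ]}
    (hJ : J ∈ imagUnits) (v : ℍ[ℝ]) {z : ℂ} (hz : ‖z‖ < 1) :
    HasSum (fun n => z ^ n • sliceProj J (c n * v))
      (sliceProj J (powerSum c (sliceEmb J z) * v)) := by
  have h1 := (hc.summable (z := sliceEmb J z) (by rwa [norm_sliceEmb hJ])).hasSum
  have h2 := ((h1.mul_right v).mapL (sliceProj J))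
  refine h2.congr_fun fun n => ?_
  rw [mul_assoc, ← sliceEmb_pow hJ, sliceProj_sliceEmb_mul hJ, smul_eq_mul]

/-! ### Vandermonde bound, coefficient estimate, maximum principle -/

/-- The squared side lengths sum to `3 ∑|zᵢ|² - |∑zᵢ|² ≤ 9`, and AM-GM bounds their product by 27.
-/
theorem norm_vandermonde_three_le {z₁ z₂ z₃ : ℂ} (h₁ : ‖z₁‖ ≤ 1) (h₂ : ‖z₂‖ ≤ 1)
    (h₃ : ‖z₃‖ ≤ 1) : ‖(z₂ - z₁) * (z₃ - z₁) * (z₃ - z₂)‖ ≤ 3 * √3 := by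
  have hs : ∀ z : ℂ, ‖z‖ ≤ 1 → z.re ^ 2 + z.im ^ 2 ≤ 1 := fun z hz => by
    have := pow_le_one₀ (n := 2) (norm_nonneg z) hz
    rwa [Complex.sq_norm, Complex.normSq_apply, ← sq, ← sq] at this
  have h₁' := hs _ h₁
  have h₂' := hs _ h₂
  have h₃' := hs _ h₃
  have e : ∀ z w : ℂ, ‖z - w‖ ^ 2 = (z.re - w.re) ^ 2 + (z.im - w.im) ^ 2 := fun z w => by
    rw [Complex.sq_norm, Complex.normSq_apply]; simp; ring
  have hsum : ‖z₂ - z₁‖ ^ 2 + ‖z₃ - z₁‖ ^ 2 + ‖z₃ - z₂‖ ^ 2 ≤ 9 := by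
    rw [e, e, e]
    nlinarith [sq_nonneg (z₁.re + z₂.re + z₃.re), sq_nonneg (z₁.im + z₂.im + z₃.im)]
  have amgm : ∀ A B D : ℝ, 0 ≤ A → 0 ≤ B → 0 ≤ D → A + B + D ≤ 9 → A * B * D ≤ 27 := by
    intro A B D hA hB hD h
    have h1 : A * B ≤ ((9 - D) / 2) ^ 2 := by
      nlinarith [sq_nonneg (A - B)]
    have h2 : A * B * D ≤ ((9 - D) / 2) ^ 2 * D := mul_le_mul_of_nonneg_right h1 hD
    have h3 : ((9 - D) / 2) ^ 2 * D ≤ 27 := by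
      nlinarith [mul_nonneg (sq_nonneg (D - 3)) (show (0 : ℝ) ≤ 12 - D by linarith)]
    linarith
  refine abs_le_of_sq_le_sq' ?_ (by positivity) |>.2
  rw [norm_mul, norm_mul, mul_pow, mul_pow, mul_pow, Real.sq_sqrt (by norm_num)]
  have := amgm _ _ _ (sq_nonneg ‖z₂ - z₁‖) (sq_nonneg ‖z₃ - z₁‖) (sq_nonneg ‖z₃ - z₂‖) hsum
  linarith

/-- Once the constant term is rotated to be nonnegative, the real part of `H - γ₀` is at most `A -
|γ₀|`. Borel–Carathéodory then bounds `|H - γ₀|` on half the radius, and Cauchy's estimate bounds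
each coefficient linearly in the defect `A - |γ₀|`. -/
theorem norm_coeff_le_of_norm_le {γ : ℕ → ℂ} {H : ℂ → ℂ}
    (h : ∀ z : ℂ, ‖z‖ < 1 → HasSum (fun n => z ^ n • γ n) (H z)) {s A : ℝ} (hs : 0 < s)
    (hs1 : s ≤ 1) (hA : ∀ z, ‖z‖ < s → ‖H z‖ ≤ A) {k : ℕ} (hk : k ≠ 0) :
    ‖γ k‖ ≤ 2 / (s / 2) ^ k * (A - ‖γ 0‖) := by
  have h0 : H 0 = γ 0 := by
    refine (h 0 (by simp)).unique ?_
    convert! hasSum_single (f := fun n => (0 : ℂ) ^ n • γ n) 0 ?_ using 1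
    · simp
    · intro n hn
      simp [hn]
  have hG : ∀ z : ℂ, ‖z‖ < 1 → HasSum (fun n => z ^ n • Function.update γ 0 0 n) (H z - γ 0) := by
    intro z hz
    have := (h z hz).update 0 0
    convert! this using 1
    · funext n
      rcases eq_or_ne n 0 with rfl | hn
      · simp
      · simp [hn]
    · simp; ring
  have hd := differentiableOn_of_hasSum hG
  have hit := iteratedDeriv_of_hasSum hG k
  rw [Function.update_of_ne hk] at hit
  have hAn : 0 ≤ A - ‖γ 0‖ := by
    have := hA 0 (by simpa using hs)
    rw [h0] at this
    linarith
  obtain ⟨u, hu, hu'⟩ : ∃ u : ℂ, ‖u‖ = 1 ∧ u * γ 0 = ‖γ 0‖ := by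
    by_cases hγ : γ 0 = 0
    · exact ⟨1, by simp, by simp [hγ]⟩
    · have hn : (‖γ 0‖ : ℂ) ≠ 0 := by simpa using hγ
      refine ⟨(starRingEnd ℂ) (γ 0) / ‖γ 0‖, ?_, ?_⟩
      · rw [norm_div, RCLike.norm_conj, Complex.norm_real, norm_norm, div_self]
        simpa using hγ
      · rw [div_mul_eq_mul_div, mul_comm, Complex.mul_conj, Complex.normSq_eq_norm_sq]
        push_cast
        field_simp
  -- Borel–Carathéodory needs a positive bound, while the defect may be 0; hence `M` is strictly
  -- larger and then tends to it.
  have key : ∀ M, A - ‖γ 0‖ < M → ‖γ k‖ ≤ 2 / (s / 2) ^ k * M := by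
    intro M hM
    have hb : ∀ z : ℂ, ‖z‖ = s / 2 → ‖H z - γ 0‖ ≤ 2 * M := by
      intro z hz
      have hz' : z ∈ Metric.ball (0 : ℂ) s := by
        rw [mem_ball_zero_iff, hz]; linarith
      have := Complex.borelCaratheodory_zero (f := fun z => u * (H z - γ 0)) (M := M) (R := s)
        (z := z) (by linarith)
        ((hd.mono (Metric.ball_subset_ball hs1)).const_mul u) ?_ hs hz' ?_
      · rw [norm_mul, hu, one_mul, hz] at this
        refine this.trans (le_of_eq ?_)
        field_simp
        ring
      · intro w hw
        have h1 : (u * H w).re ≤ A := by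
          refine (Complex.re_le_norm _).trans ?_
          rw [norm_mul, hu, one_mul]
          exact hA w (mem_ball_zero_iff.1 hw)
        change (u * (H w - γ 0)).re ≤ M
        rw [mul_sub, hu', Complex.sub_re, Complex.ofReal_re]
        linarith
      · simp [h0]
    have hdc : DiffContOnCl ℂ (fun z => H z - γ 0) (Metric.ball 0 (s / 2)) := by
      refine DifferentiableOn.diffContOnCl (hd.mono ?_)
      rw [closure_ball _ (by positivity)]
      exact Metric.closedBall_subset_ball (by linarith)
    have hc := Complex.norm_iteratedDeriv_le_of_forall_mem_sphere_norm_le k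
      (show 0 < s / 2 by positivity) hdc fun z hz => hb z (mem_sphere_zero_iff_norm.1 hz)
    rw [hit, norm_smul, Complex.norm_natCast, mul_div_assoc] at hc
    have := le_of_mul_le_mul_left hc (by positivity)
    refine this.trans (le_of_eq ?_)
    ring
  have ht : Filter.Tendsto (fun M => 2 / (s / 2) ^ k * M) (nhdsWithin (A - ‖γ 0‖) (Set.Ioi (A - ‖γ 0‖)))
      (nhds (2 / (s / 2) ^ k * (A - ‖γ 0‖))) :=
    ((continuous_const.mul continuous_id).tendsto _).mono_left nhdsWithin_le_nhds
  exact ge_of_tendsto ht (Filter.eventually_of_mem self_mem_nhdsWithin key)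

/-- Dividing by the value `p` at `z₀` gives a projection equal to 1 at an interior maximum of its
modulus. It is therefore constantly 1, and its value at 0 is at most `‖c 0‖ / ‖p‖`. -/
theorem ConvergesOnBall.le_norm_coeff_zero {c : ℕ → ℍ[ℝ]} (hc : ConvergesOnBall c) {J : ℍ[ℝ]}
    (hJ : J ∈ imagUnits) {s K : ℝ} (hs1 : s ≤ 1)
    (hK : ∀ z : ℂ, ‖z‖ < s → ‖powerSum c (sliceEmb J z)‖ ≤ K) {z₀ : ℂ} (hz₀ : ‖z₀‖ < s)
    (h : K ≤ ‖powerSum c (sliceEmb J z₀)‖) : K ≤ ‖c 0‖ := by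
  set p := powerSum c (sliceEmb J z₀) with hp
  rcases eq_or_ne p 0 with h0 | h0
  · rw [h0, norm_zero] at h
    exact h.trans (norm_nonneg _)
  have hp0 : 0 < ‖p‖ := norm_pos_iff.2 h0
  set H : ℂ → ℂ := fun z => sliceProj J (powerSum c (sliceEmb J z) * p⁻¹) with hH
  have hsum : ∀ z : ℂ, ‖z‖ < 1 → HasSum (fun n => z ^ n • sliceProj J (c n * p⁻¹)) (H z) :=
    fun z hz => hc.hasSum_sliceProj hJ _ hz
  have hd := (differentiableOn_of_hasSum hsum).mono (Metric.ball_subset_ball hs1)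
  have hH0 : H z₀ = 1 := by
    rw [hH]
    simp only
    rw [← hp, mul_inv_cancel₀ h0, sliceProj_apply, ← Complex.ofReal_one]
    apply Complex.ext <;> simp [(mem_imagUnits_iff.1 hJ).1]
  have hmax : IsMaxOn (norm ∘ H) (Metric.ball 0 s) z₀ := fun z hz => by
    change ‖H z‖ ≤ ‖H z₀‖
    rw [hH0, norm_one]
    refine (norm_sliceProj_le hJ _).trans ?_
    rw [norm_mul, norm_inv, ← div_eq_mul_inv, div_le_one hp0]
    exact (hK z (mem_ball_zero_iff.1 hz)).trans h
  have hs : 0 < s := (norm_nonneg _).trans_lt hz₀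
  have h1 : H 0 = H z₀ := Complex.eq_const_of_exists_max hd (mem_ball_zero_iff.2 hz₀) hmax
    (mem_ball_zero_iff.2 (by simpa using hs))
  have h2 : ‖H 0‖ ≤ ‖c 0‖ / ‖p‖ := by
    refine (norm_sliceProj_le hJ _).trans ?_
    rw [sliceEmb_zero, powerSum_zero, norm_mul, norm_inv, div_eq_mul_inv]
  rw [h1, hH0, norm_one, one_le_div hp0] at h2
  refine le_trans ?_ h2
  exact h

theorem ConvergesOnBall.norm_powerSum_le {c : ℕ → ℍ[ℝ]} (hc : ConvergesOnBall c) {J : ℍ[ℝ]}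
    (hJ : J ∈ imagUnits) {s K : ℝ} (hs0 : 0 < s) (hs1 : s < 1)
    (hK : ∀ z : ℂ, ‖z‖ = s → ‖powerSum c (sliceEmb J z)‖ ≤ K) {z : ℂ} (hz : ‖z‖ ≤ s) :
    ‖powerSum c (sliceEmb J z)‖ ≤ K := by
  set p := powerSum c (sliceEmb J z) with hp
  rcases eq_or_ne p 0 with h0 | h0
  · rw [h0, norm_zero]
    exact (norm_nonneg _).trans (hK s (by simpa using hs0.le))
  have hp0 : 0 < ‖p‖ := norm_pos_iff.2 h0
  set H : ℂ → ℂ := fun z => sliceProj J (powerSum c (sliceEmb J z) * p⁻¹) with hH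
  have hsum : ∀ z : ℂ, ‖z‖ < 1 → HasSum (fun n => z ^ n • sliceProj J (c n * p⁻¹)) (H z) :=
    fun z hz => hc.hasSum_sliceProj hJ _ hz
  have hd : DiffContOnCl ℂ H (Metric.ball 0 s) := by
    refine DifferentiableOn.diffContOnCl ((differentiableOn_of_hasSum hsum).mono ?_)
    rw [closure_ball _ hs0.ne']
    exact Metric.closedBall_subset_ball hs1
  have hH0 : H z = 1 := by
    rw [hH]
    simp only
    rw [← hp, mul_inv_cancel₀ h0, sliceProj_apply, ← Complex.ofReal_one]
    apply Complex.ext <;> simp [(mem_imagUnits_iff.1 hJ).1]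
  have h1 : ‖H z‖ ≤ K / ‖p‖ := by
    refine Complex.norm_le_of_forall_mem_frontier_norm_le Metric.isBounded_ball hd (fun w hw => ?_)
      (by rw [closure_ball _ hs0.ne']; exact mem_closedBall_zero_iff.2 hz)
    rw [frontier_ball _ hs0.ne'] at hw
    refine (norm_sliceProj_le hJ _).trans ?_
    rw [norm_mul, norm_inv, div_eq_mul_inv]
    gcongr
    exact hK w (mem_sphere_zero_iff_norm.1 hw)
  rwa [hH0, norm_one, one_le_div hp0] at h1

/-! ### First-order test at the cube roots of unity -/

/-- The leading non-constant coefficient of the normalized power series `ĝ`, as a polynomial in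
complex numbers `z₁, z₂, z₃`. -/
def leadingPoly (m : ℕ) (x y t z₁ z₂ z₃ : ℂ) : ℂ :=
  (z₂ ^ m - z₁ ^ m) * (z₃ - z₁) * (z₃ - z₂) * x + (z₂ - z₁) * (z₃ ^ m - z₁ ^ m) * (z₃ - z₂) * y +
    (z₂ - z₁) * (z₃ - z₁) * (z₃ ^ m - z₂ ^ m) * t

theorem leadingPoly_swap (m : ℕ) (x y t z₁ z₂ z₃ : ℂ) :
    leadingPoly m x y t z₂ z₁ z₃ = -leadingPoly m x t y z₁ z₂ z₃ := by
  unfold leadingPoly; ring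

theorem hasDerivAt_zero_of_norm_le_sq {φ : ℝ → ℂ} {C : ℝ} (h : ∀ θ, ‖φ θ‖ ≤ C * θ ^ 2) :
    φ 0 = 0 ∧ HasDerivAt φ 0 0 := by
  have h0 : φ 0 = 0 := by simpa using h 0
  refine ⟨h0, ?_⟩
  have hO : φ =O[nhds 0] fun θ : ℝ => θ ^ 2 :=
    Asymptotics.IsBigO.of_bound C (Filter.Eventually.of_forall fun θ => by
      simpa using h θ)
  rw [hasDerivAt_iff_isLittleO]
  simp only [h0, sub_zero, smul_zero]
  exact hO.trans_isLittleO (Asymptotics.isLittleO_pow_id one_lt_two)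

/-- The hypotheses make `1, a, c` the cube roots of unity. Moving `z₁ = e^{iθ}` away from 1 costs
only `O(θ²)` in `|V|`, so the polynomial and its θ-derivative both vanish at `θ = 0`; combining the
two eliminates `t`. -/
theorem linear_relation_of_norm_leadingPoly_le {m : ℕ} {x y t : ℂ} {C : ℝ} (hC : 0 ≤ C)
    (h : ∀ z₁ z₂ z₃ : ℂ, ‖z₁‖ ≤ 1 → ‖z₂‖ ≤ 1 → ‖z₃‖ ≤ 1 →
      ‖leadingPoly m x y t z₁ z₂ z₃‖ ≤ C * (3 * √3 - ‖(z₂ - z₁) * (z₃ - z₁) * (z₃ - z₂)‖))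
    {a c : ℂ} (hac : a * c = 1) (hac' : a + c = -1) (ha : ‖a‖ = 1) (hc : ‖c‖ = 1) :
    (m * (c - 1) + c * (a ^ m - 1)) * x + (m * (a - 1) + a * (c ^ m - 1)) * y = 0 := by
  have hsq : (c - a) ^ 2 = -3 := by linear_combination (a + c - 1) * hac' - 4 * hac
  have hne : c - a ≠ 0 := fun h0 => by
    rw [h0] at hsq; norm_num at hsq
  have hnorm : ‖c - a‖ = √3 := by
    have : ‖c - a‖ ^ 2 = 3 := by rw [← norm_pow, hsq]; simp
    rw [← this, Real.sqrt_sq (norm_nonneg _)]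
  set e : ℝ → ℂ := fun θ => Complex.exp (θ * Complex.I) with he
  have hb : ∀ θ : ℝ, ‖leadingPoly m x y t (e θ) a c‖ ≤ C * √3 * θ ^ 2 := by
    intro θ
    have hv : ‖(a - e θ) * (c - e θ) * (c - a)‖ = |1 + 2 * Real.cos θ| * √3 := by
      -- With `e = e θ`, `(a - e)(c - e) = e² + e + 1 = e (1 + 2 cos θ)`.
      have h1 : (a - e θ) * (c - e θ) = e θ * ((1 + 2 * Real.cos θ : ℝ) : ℂ) := by
        have h2 : ((1 + 2 * Real.cos θ : ℝ) : ℂ) = 1 + (e θ + Complex.exp (-(θ * Complex.I))) := by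
          push_cast
          rw [Complex.two_cos, neg_mul]
        have h3 : e θ * Complex.exp (-(θ * Complex.I)) = 1 := by
          rw [he]; simp only; rw [← Complex.exp_add, add_neg_cancel, Complex.exp_zero]
        rw [h2]
        linear_combination hac - e θ * hac' - h3
      rw [norm_mul, h1, norm_mul, hnorm, Complex.norm_exp_ofReal_mul_I, one_mul, Complex.norm_real,
        Real.norm_eq_abs]
    refine (h _ _ _ (Complex.norm_exp_ofReal_mul_I θ).le ha.le hc.le).trans ?_
    rw [hv, mul_assoc]
    refine mul_le_mul_of_nonneg_left ?_ hC
    have h4 := Real.one_sub_sq_div_two_le_cos (x := θ)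
    have h5 := le_abs_self (1 + 2 * Real.cos θ)
    have h6 : (3 - |1 + 2 * Real.cos θ|) * √3 ≤ θ ^ 2 * √3 :=
      mul_le_mul_of_nonneg_right (by linarith) (Real.sqrt_nonneg 3)
    linarith
  obtain ⟨h0, hd⟩ := hasDerivAt_zero_of_norm_le_sq hb
  have he0 : e 0 = 1 := by simp [he]
  have hde : HasDerivAt e Complex.I 0 := by
    have := ((hasDerivAt_id (0 : ℝ)).ofReal_comp.mul_const Complex.I).cexp
    simpa using this
  have hdm : HasDerivAt (fun θ => e θ ^ m) (m * Complex.I) 0 := by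
    have := hde.fun_pow m
    simpa [he0] using this
  have hd' : HasDerivAt (fun θ => leadingPoly m x y t (e θ) a c)
      (((-(m * Complex.I)) * (c - 1) + (a ^ m - 1) * (-Complex.I)) * (c - a) * x +
        ((-Complex.I) * (c ^ m - 1) + (a - 1) * (-(m * Complex.I))) * (c - a) * y +
        ((-Complex.I) * (c - 1) + (a - 1) * (-Complex.I)) * (c ^ m - a ^ m) * t) 0 := by
    have h1 := (hdm.const_sub (a ^ m)).mul (hde.const_sub c)
    have h2 := (hde.const_sub a).mul (hdm.const_sub (c ^ m))
    have h3 := (hde.const_sub a).mul (hde.const_sub c)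
    have h4 := (((h1.mul_const (c - a)).mul_const x).add ((h2.mul_const (c - a)).mul_const y)).add
      ((h3.mul_const (c ^ m - a ^ m)).mul_const t)
    simp only [he0, one_pow] at h4
    exact h4
  have hE' := hd'.unique hd
  rw [leadingPoly, he0, one_pow] at h0
  have hfin : Complex.I * (c - a) *
      ((m * (c - 1) + c * (a ^ m - 1)) * x + (m * (a - 1) + a * (c ^ m - 1)) * y) = 0 := by
    linear_combination -hE' + Complex.I * h0 - Complex.I * (c ^ m - a ^ m) * t * hac
  exact (mul_eq_zero.1 hfin).resolve_left (mul_ne_zero Complex.I_ne_zero hne)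

theorem add_eq_zero_of_norm_leadingPoly_le {m : ℕ} (hm : 2 ≤ m) {x y t : ℂ} {C : ℝ} (hC : 0 ≤ C)
    (h : ∀ z₁ z₂ z₃ : ℂ, ‖z₁‖ ≤ 1 → ‖z₂‖ ≤ 1 → ‖z₃‖ ≤ 1 →
      ‖leadingPoly m x y t z₁ z₂ z₃‖ ≤ C * (3 * √3 - ‖(z₂ - z₁) * (z₃ - z₁) * (z₃ - z₂)‖)) :
    x + y = 0 := by
  obtain ⟨a, c, hac, hac', ha, hc⟩ : ∃ a c : ℂ, a * c = 1 ∧ a + c = -1 ∧ ‖a‖ = 1 ∧ ‖c‖ = 1 := by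
    have hs : √3 * √3 = 3 := Real.mul_self_sqrt (by norm_num)
    have hn : ∀ z : ℂ, z.re ^ 2 + z.im ^ 2 = 1 → ‖z‖ = 1 := fun z hz => by
      have : ‖z‖ ^ 2 = 1 := by rw [Complex.sq_norm, Complex.normSq_apply, ← hz]; ring
      exact (pow_eq_one_iff_of_nonneg (norm_nonneg z) two_ne_zero).1 this
    refine ⟨⟨-1 / 2, √3 / 2⟩, ⟨-1 / 2, -(√3 / 2)⟩, ?_, ?_, hn _ ?_, hn _ ?_⟩
    · apply Complex.ext <;> simp <;> linarith
    · apply Complex.ext <;> simp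
    · simp only; linarith
    · simp only; linarith
  have h1 := linear_relation_of_norm_leadingPoly_le hC h hac hac' ha hc
  have h2 := linear_relation_of_norm_leadingPoly_le hC h (mul_comm a c ▸ hac)
    (add_comm a c ▸ hac') hc ha
  -- Adding the relations for the two orders of `a, c` symmetrizes the coefficients of `x` and `y`;
  -- the factor is nonzero because `3m - 1 ≥ 5 > 2`.
  have h3 : ((c * a ^ m + a * c ^ m) - ((3 * m - 1 : ℝ) : ℂ)) * (x + y) = 0 := by
    push_cast
    linear_combination h1 + h2 - (m - 1) * (x + y) * hac'
  refine (mul_eq_zero.1 h3).resolve_left fun h4 => ?_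
  have h5 : ‖c * a ^ m + a * c ^ m‖ ≤ 2 := by
    refine (norm_add_le _ _).trans ?_
    rw [norm_mul, norm_mul, norm_pow, norm_pow, ha, hc]
    norm_num
  rw [sub_eq_zero.1 h4, Complex.norm_real] at h5
  have h6 := (le_abs_self _).trans h5
  have h7 : (2 : ℝ) ≤ m := by exact_mod_cast hm
  linarith

/-! ### Exceeding the Vandermonde bound -/

/-- The coefficients of `ĝ_{w₁,w₂,w₃}(z) / z³`. -/
def hCoeff (b : ℕ → ℍ[ℝ]) (w₁ w₂ w₃ : ℍ[ℝ]) (n : ℕ) : ℍ[ℝ] := gCoeff b w₁ w₂ w₃ (n + 3)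

theorem ConvergesOnBall.hCoeff {b : ℕ → ℍ[ℝ]} (hb : ConvergesOnBall b) {w₁ w₂ w₃ : ℍ[ℝ]}
    (h₁ : ‖w₁‖ ≤ 1) (h₂ : ‖w₂‖ ≤ 1) (h₃ : ‖w₃‖ ≤ 1) : ConvergesOnBall (hCoeff b w₁ w₂ w₃) :=
  (hb.gCoeff h₁ h₂ h₃).shift 3

theorem hCoeff_zero (b : ℕ → ℍ[ℝ]) (I : ℍ[ℝ]) (hI : I ∈ imagUnits) (z₁ z₂ z₃ : ℂ) :
    hCoeff b (sliceEmb I z₁) (sliceEmb I z₂) (sliceEmb I z₃) 0 =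
      sliceEmb I ((z₂ - z₁) * (z₃ - z₁) * (z₃ - z₂)) * b 1 * b 1 * b 1 := by
  rw [hCoeff, zero_add, gCoeff_three]
  simp only [sliceEmb_mul hI, sliceEmb_sub]

theorem sliceProj_one {I : ℍ[ℝ]} (hI : I ∈ imagUnits) : sliceProj I 1 = 1 := by
  rw [sliceProj_apply]
  apply Complex.ext <;> simp [(mem_imagUnits_iff.1 hI).1]

theorem exists_norm_hCoeff_gt_of_coeff_one_eq_zero {b : ℕ → ℍ[ℝ]} (hb : ConvergesOnBall b)
    {m : ℕ} (hm : 2 ≤ m) (hbm : b m ≠ 0) (hlt : ∀ n, 2 ≤ n → n < m → b n = 0) (h1 : b 1 = 0)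
    {s : ℝ} (hs0 : 0 < s) (hs1 : s ≤ 1) {I : ℍ[ℝ]} (hI : I ∈ imagUnits) :
    ∃ z₁ z₂ z₃ : ℂ, ‖z₁‖ ≤ 1 ∧ ‖z₂‖ ≤ 1 ∧ ‖z₃‖ ≤ 1 ∧ ∃ z : ℂ, ‖z‖ < s ∧
      0 < ‖powerSum (hCoeff b (sliceEmb I z₁) (sliceEmb I z₂) (sliceEmb I z₃)) (sliceEmb I z)‖ := by
  have hm0 : (m : ℂ) ≠ 0 := by
    have : m ≠ 0 := by omega
    exact_mod_cast this
  set w : ℂ := Complex.exp ((Real.pi / m : ℝ) * Complex.I) with hw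
  have hwn : ‖w‖ = 1 := Complex.norm_exp_ofReal_mul_I _
  have hwm : w ^ m = -1 := by
    rw [hw, ← Complex.exp_nat_mul, ← Complex.exp_pi_mul_I]
    congr 1
    push_cast
    field_simp
  -- Since `w ^ m = -1`, the m-th powers 0, 1, -1 are distinct, so their Vandermonde product is
  -- nonzero.
  refine ⟨0, 1, w, by simp, by simp, hwn.le, ?_⟩
  by_contra! hcon
  have hc : ConvergesOnBall (hCoeff b (sliceEmb I 0) (sliceEmb I 1) (sliceEmb I w)) :=
    hb.hCoeff (by simp) (by rw [norm_sliceEmb hI, norm_one]) (by rw [norm_sliceEmb hI, hwn])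
  set c := hCoeff b (sliceEmb I 0) (sliceEmb I 1) (sliceEmb I w) with hcdef
  have hne : c (3 * m - 3) ≠ 0 := by
    rw [hcdef, hCoeff, Nat.sub_add_cancel (by omega), gCoeff_three_mul _ _ _ fun n hn hnm => by
      rcases hn.eq_or_lt with rfl | hn'
      · exact h1
      · exact hlt n hn' hnm]
    simp only [← sliceEmb_pow hI, ← sliceEmb_sub, ← sliceEmb_mul hI]
    have hm' : m ≠ 0 := by omega
    have : sliceEmb I ((1 ^ m - 0 ^ m) * (w ^ m - 0 ^ m) * (w ^ m - 1 ^ m)) ≠ 0 := by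
      rw [← norm_ne_zero_iff, norm_sliceEmb hI, hwm, one_pow, zero_pow hm']
      norm_num
    exact mul_ne_zero (mul_ne_zero (mul_ne_zero this hbm) hbm) hbm
  have := norm_coeff_le_of_norm_le
    (fun z hz => hc.hasSum_sliceProj hI (c (3 * m - 3))⁻¹ hz) hs0 hs1 (A := 0) (fun z hz => by
      refine (norm_sliceProj_le hI _).trans ?_
      rw [norm_mul]
      exact mul_nonpos_of_nonpos_of_nonneg (hcon z hz) (norm_nonneg _))
    (k := 3 * m - 3) (by omega)
  rw [mul_inv_cancel₀ hne, sliceProj_one hI, norm_one] at this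
  have h2 : 2 / (s / 2) ^ (3 * m - 3) * (0 - ‖sliceProj I (c 0 * (c (3 * m - 3))⁻¹)‖) ≤ 0 :=
    mul_nonpos_of_nonneg_of_nonpos (by positivity) (by simp)
  linarith

theorem norm_leadingPoly_le {b : ℕ → ℍ[ℝ]} (hb : ConvergesOnBall b) {m : ℕ} (hm : 2 ≤ m)
    (hlt : ∀ n, 2 ≤ n → n < m → b n = 0) (h1 : b 1 ≠ 0) {s : ℝ} (hs0 : 0 < s) (hs1 : s ≤ 1)
    {I : ℍ[ℝ]} (hI : I ∈ imagUnits)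
    (hle : ∀ z₁ z₂ z₃ : ℂ, ‖z₁‖ ≤ 1 → ‖z₂‖ ≤ 1 → ‖z₃‖ ≤ 1 → ∀ z : ℂ, ‖z‖ < s →
      ‖powerSum (hCoeff b (sliceEmb I z₁) (sliceEmb I z₂) (sliceEmb I z₃)) (sliceEmb I z)‖ ≤
        3 * √3 * ‖b 1‖ ^ 3)
    {z₁ z₂ z₃ : ℂ} (hz₁ : ‖z₁‖ ≤ 1) (hz₂ : ‖z₂‖ ≤ 1) (hz₃ : ‖z₃‖ ≤ 1) :
    ‖leadingPoly m (sliceProj I (b m * b 1 * b 1 * (b 1 * b 1 * b 1)⁻¹))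
      (sliceProj I (b 1 * b m * b 1 * (b 1 * b 1 * b 1)⁻¹))
      (sliceProj I (b 1 * b 1 * b m * (b 1 * b 1 * b 1)⁻¹)) z₁ z₂ z₃‖ ≤
      2 / (s / 2) ^ (m - 1) * (3 * √3 - ‖(z₂ - z₁) * (z₃ - z₁) * (z₃ - z₂)‖) := by
  have hc : ConvergesOnBall (hCoeff b (sliceEmb I z₁) (sliceEmb I z₂) (sliceEmb I z₃)) :=
    hb.hCoeff (by rwa [norm_sliceEmb hI]) (by rwa [norm_sliceEmb hI]) (by rwa [norm_sliceEmb hI])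
  have hv : b 1 * b 1 * b 1 ≠ 0 := mul_ne_zero (mul_ne_zero h1 h1) h1
  have := norm_coeff_le_of_norm_le
    (fun z hz => hc.hasSum_sliceProj hI (b 1 * b 1 * b 1)⁻¹ hz) hs0 hs1 (A := 3 * √3)
    (fun z hz => by
      refine (norm_sliceProj_le hI _).trans ?_
      rw [norm_mul, norm_inv, ← div_eq_mul_inv, div_le_iff₀ (norm_pos_iff.2 hv), norm_mul, norm_mul]
      refine (hle z₁ z₂ z₃ hz₁ hz₂ hz₃ z hz).trans (le_of_eq ?_)
      ring)
    (k := m - 1) (by omega)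
  rw [hCoeff_zero b I hI] at this
  -- Dividing by `b₁³` on the right leaves the bare Vandermonde product as constant term.
  have e0 : sliceEmb I ((z₂ - z₁) * (z₃ - z₁) * (z₃ - z₂)) * b 1 * b 1 * b 1 *
      (b 1 * b 1 * b 1)⁻¹ = sliceEmb I ((z₂ - z₁) * (z₃ - z₁) * (z₃ - z₂)) * 1 := by
    rw [← mul_inv_cancel₀ hv]; simp only [mul_assoc]
  rw [e0, sliceProj_sliceEmb_mul hI, sliceProj_one hI, mul_one] at this
  have e1 : sliceProj I (hCoeff b (sliceEmb I z₁) (sliceEmb I z₂) (sliceEmb I z₃) (m - 1) *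
      (b 1 * b 1 * b 1)⁻¹) = leadingPoly m (sliceProj I (b m * b 1 * b 1 * (b 1 * b 1 * b 1)⁻¹))
      (sliceProj I (b 1 * b m * b 1 * (b 1 * b 1 * b 1)⁻¹))
      (sliceProj I (b 1 * b 1 * b m * (b 1 * b 1 * b 1)⁻¹)) z₁ z₂ z₃ := by
    rw [hCoeff, show m - 1 + 3 = m + 2 by omega, gCoeff_add_two _ _ _ hm hlt, leadingPoly,
      ← sliceProj_sliceEmb_mul hI, ← sliceProj_sliceEmb_mul hI, ← sliceProj_sliceEmb_mul hI,
      ← map_add, ← map_add]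
    simp only [sliceEmb_mul hI, sliceEmb_sub, sliceEmb_pow hI]
    congr 1
    simp only [add_mul, mul_assoc]
  rwa [e1] at this

theorem exists_norm_hCoeff_gt {b : ℕ → ℍ[ℝ]} (hb : ConvergesOnBall b)
    (hne : ∃ n, 2 ≤ n ∧ b n ≠ 0) {s : ℝ} (hs0 : 0 < s) (hs1 : s ≤ 1) :
    ∃ I ∈ imagUnits, ∃ z₁ z₂ z₃ : ℂ, ‖z₁‖ ≤ 1 ∧ ‖z₂‖ ≤ 1 ∧ ‖z₃‖ ≤ 1 ∧ ∃ z : ℂ, ‖z‖ < s ∧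
      3 * √3 * ‖b 1‖ ^ 3 <
        ‖powerSum (hCoeff b (sliceEmb I z₁) (sliceEmb I z₂) (sliceEmb I z₃)) (sliceEmb I z)‖ := by
  classical
  obtain ⟨hm, hbm⟩ := Nat.find_spec hne
  set m := Nat.find hne with hmdef
  have hlt : ∀ n, 2 ≤ n → n < m → b n = 0 := fun n h2 hn => by
    have := Nat.find_min hne hn
    by_contra h
    exact this ⟨h2, h⟩
  by_cases h1 : b 1 = 0
  · obtain ⟨I, hI⟩ := imagUnits_nonempty
    refine ⟨I, hI, ?_⟩
    simpa [h1] using exists_norm_hCoeff_gt_of_coeff_one_eq_zero hb hm hbm hlt h1 hs0 hs1 hI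
  by_contra! hcon
  have hv : b 1 * b 1 * b 1 ≠ 0 := mul_ne_zero (mul_ne_zero h1 h1) h1
  have hC : (0 : ℝ) ≤ 2 / (s / 2) ^ (m - 1) := by positivity
  have hP := fun {I : ℍ[ℝ]} (hI : I ∈ imagUnits) (z₁ z₂ z₃ : ℂ) (hz₁ : ‖z₁‖ ≤ 1)
    (hz₂ : ‖z₂‖ ≤ 1) (hz₃ : ‖z₃‖ ≤ 1) =>
      norm_leadingPoly_le hb hm hlt h1 hs0 hs1 hI (hcon I hI) hz₁ hz₂ hz₃
  have hxy : b m * b 1 * b 1 + b 1 * b m * b 1 = 0 := by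
    have : (b m * b 1 * b 1 + b 1 * b m * b 1) * (b 1 * b 1 * b 1)⁻¹ = 0 :=
      eq_zero_of_sliceProj_eq_zero fun I hI => by
        rw [add_mul, map_add]
        exact add_eq_zero_of_norm_leadingPoly_le hm hC (hP hI)
    exact (mul_eq_zero.1 this).resolve_right (inv_ne_zero hv)
  -- Exchanging `z₁` and `z₂` interchanges the roles of `y` and `t`, up to sign.
  have hxt : b m * b 1 * b 1 + b 1 * b 1 * b m = 0 := by
    have : (b m * b 1 * b 1 + b 1 * b 1 * b m) * (b 1 * b 1 * b 1)⁻¹ = 0 :=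
      eq_zero_of_sliceProj_eq_zero fun I hI => by
        rw [add_mul, map_add]
        refine add_eq_zero_of_norm_leadingPoly_le
          (t := sliceProj I (b 1 * b m * b 1 * (b 1 * b 1 * b 1)⁻¹)) hm hC fun z₁ z₂ z₃ hz₁ hz₂ hz₃ => ?_
        have := hP hI z₂ z₁ z₃ hz₂ hz₁ hz₃
        rw [leadingPoly_swap, norm_neg] at this
        refine this.trans (le_of_eq ?_)
        rw [show (z₁ - z₂) * (z₃ - z₂) * (z₃ - z₁) = -((z₂ - z₁) * (z₃ - z₁) * (z₃ - z₂)) by ring,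
          norm_neg]
    exact (mul_eq_zero.1 this).resolve_right (inv_ne_zero hv)
  have hcomm : b m * b 1 + b 1 * b m = 0 := by
    have : (b m * b 1 + b 1 * b m) * b 1 = 0 := by rw [add_mul, hxy]
    exact (mul_eq_zero.1 this).resolve_right h1
  -- Anticommuting with `b₁` twice means commuting with `b₁²`, so `hxt` becomes `2 b_m b₁² = 0`.
  have h2 : b 1 * b m = -(b m * b 1) := (neg_eq_of_add_eq_zero_right hcomm).symm
  rw [mul_assoc (b 1), h2, mul_neg, ← mul_assoc, h2, neg_mul, neg_neg, ← two_smul ℝ] at hxt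
  simp [h1, hbm] at hxt

/-! ### Slice diameters as maxima over compact parameter sets -/

theorem IsSliceRegular.convergesOnBall_normCoeff {f : ℍ[ℝ] → ℍ[ℝ]} (hf : IsSliceRegular f) :
    ConvergesOnBall (normCoeff f) := by
  intro ρ h0 h1
  refine ((hf.summable_norm_coeff h0 h1).mul_right (‖(coeff f (firstIndex f))⁻¹‖ *
    ‖((‖coeff f (firstIndex f)‖ : ℝ) : ℍ[ℝ])‖)).congr fun n => ?_
  rw [normCoeff, norm_mul, norm_mul]
  ring

theorem normCoeff_eq_zero_iff (f : ℍ[ℝ] → ℍ[ℝ]) (n : ℕ) : normCoeff f n = 0 ↔ coeff f n = 0 := by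
  refine ⟨fun h => ?_, fun h => by rw [normCoeff, h, zero_mul, zero_mul]⟩
  by_contra hn
  -- The set is nonempty, so its `sInf` is a member and not the default 0.
  have hN : coeff f (firstIndex f) ≠ 0 := Nat.sInf_mem (s := {n : ℕ | coeff f n ≠ 0}) ⟨n, hn⟩
  have hN' : ((‖coeff f (firstIndex f)‖ : ℝ) : ℍ[ℝ]) ≠ 0 := by
    rw [← norm_ne_zero_iff, Quaternion.norm_coe, norm_norm]
    exact norm_ne_zero_iff.2 hN
  exact mul_ne_zero (mul_ne_zero hn (inv_ne_zero hN)) hN' h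

theorem norm_gHat {f : ℍ[ℝ] → ℍ[ℝ]} (hf : IsSliceRegular f) {w₁ w₂ w₃ z : ℍ[ℝ]}
    (h₁ : ‖w₁‖ ≤ 1) (h₂ : ‖w₂‖ ≤ 1) (h₃ : ‖w₃‖ ≤ 1) (hz : ‖z‖ < 1) :
    ‖gHat f w₁ w₂ w₃ z‖ = ‖z‖ ^ 3 * ‖powerSum (hCoeff (normCoeff f) w₁ w₂ w₃) z‖ := by
  have h := powerSum_eq_pow_three_mul (hf.convergesOnBall_normCoeff.gCoeff h₁ h₂ h₃)
    (fun n hn => gCoeff_eq_zero _ _ _ _ hn) hz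
  rw [gHat_eq_tsum, ← norm_pow, ← norm_mul]
  exact congrArg norm h

/-- The parameters `((I, J), z₁, z₂, z₃, z)` with `(I, J) ∈ P`, `|zᵢ| ≤ 1` and `|z| ≤ r`. -/
def diamParam (P : Set (ℍ[ℝ] × ℍ[ℝ])) (r : ℝ) : Set ((ℍ[ℝ] × ℍ[ℝ]) × (ℂ × ℂ × ℂ × ℂ)) :=
  P ×ˢ (Metric.closedBall 0 1 ×ˢ Metric.closedBall 0 1 ×ˢ Metric.closedBall 0 1 ×ˢ
    Metric.closedBall 0 r)

/-- The function `ĝ` with `w₁, w₂, w₃` in the plane `L_I` and `z` in the plane `L_J`. -/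
def gParam (f : ℍ[ℝ] → ℍ[ℝ]) (p : (ℍ[ℝ] × ℍ[ℝ]) × (ℂ × ℂ × ℂ × ℂ)) : ℍ[ℝ] :=
  gHat f (sliceEmb p.1.1 p.2.1) (sliceEmb p.1.1 p.2.2.1) (sliceEmb p.1.1 p.2.2.2.1)
    (sliceEmb p.1.2 p.2.2.2.2)

/-- The slice `3`-diameter in which `z` runs over the planes `L_J` with `(I, J) ∈ P`. -/
def pairDiam3 (f : ℍ[ℝ] → ℍ[ℝ]) (P : Set (ℍ[ℝ] × ℍ[ℝ])) (r : ℝ) : ℝ :=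
  sSup ((fun p => ‖gParam f p‖ ^ (1 / 3 : ℝ)) '' diamParam P r)

theorem mem_diamParam {P : Set (ℍ[ℝ] × ℍ[ℝ])} {r : ℝ} {I J : ℍ[ℝ]} {z₁ z₂ z₃ z : ℂ} :
    ((I, J), z₁, z₂, z₃, z) ∈ diamParam P r ↔
      (I, J) ∈ P ∧ ‖z₁‖ ≤ 1 ∧ ‖z₂‖ ≤ 1 ∧ ‖z₃‖ ≤ 1 ∧ ‖z‖ ≤ r := by
  simp [diamParam]

theorem sliceDiam3_eq (f : ℍ[ℝ] → ℍ[ℝ]) (r : ℝ) :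
    sliceDiam3 f r = pairDiam3 f (imagUnits ×ˢ imagUnits) r := by
  rw [sliceDiam3, pairDiam3]
  congr 1
  ext d
  constructor
  · rintro ⟨I, hI, w₁, ⟨hw₁, hw₁'⟩, w₂, ⟨hw₂, hw₂'⟩, w₃, ⟨hw₃, hw₃'⟩, z, hz, rfl⟩
    obtain ⟨z₁, rfl⟩ := mem_plane_iff.1 hw₁
    obtain ⟨z₂, rfl⟩ := mem_plane_iff.1 hw₂
    obtain ⟨z₃, rfl⟩ := mem_plane_iff.1 hw₃
    obtain ⟨J, hJ, z, rfl⟩ := exists_mem_plane z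
    rw [mem_closedBall_zero_iff, norm_sliceEmb hI] at hw₁' hw₂' hw₃'
    rw [mem_closedBall_zero_iff, norm_sliceEmb hJ] at hz
    exact ⟨((I, J), z₁, z₂, z₃, z), mem_diamParam.2 ⟨⟨hI, hJ⟩, hw₁', hw₂', hw₃', hz⟩, rfl⟩
  · rintro ⟨⟨⟨I, J⟩, z₁, z₂, z₃, z⟩, h, rfl⟩
    obtain ⟨⟨hI, hJ⟩, h₁, h₂, h₃, hz⟩ := mem_diamParam.1 h
    dsimp only at hI hJ
    refine ⟨I, hI, sliceEmb I z₁, ⟨mem_plane_iff.2 ⟨z₁, rfl⟩, ?_⟩, sliceEmb I z₂,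
      ⟨mem_plane_iff.2 ⟨z₂, rfl⟩, ?_⟩, sliceEmb I z₃, ⟨mem_plane_iff.2 ⟨z₃, rfl⟩, ?_⟩,
      sliceEmb J z, ?_, rfl⟩ <;> rw [mem_closedBall_zero_iff]
    · rwa [norm_sliceEmb hI]
    · rwa [norm_sliceEmb hI]
    · rwa [norm_sliceEmb hI]
    · rwa [norm_sliceEmb hJ]

theorem planeDiam3_eq (f : ℍ[ℝ] → ℍ[ℝ]) (r : ℝ) :
    planeDiam3 f r = pairDiam3 f ((fun I => (I, I)) '' imagUnits) r := by
  rw [planeDiam3, pairDiam3]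
  congr 1
  ext d
  constructor
  · rintro ⟨I, hI, w₁, ⟨hw₁, hw₁'⟩, w₂, ⟨hw₂, hw₂'⟩, w₃, ⟨hw₃, hw₃'⟩, z, ⟨hz, hz'⟩, rfl⟩
    obtain ⟨z₁, rfl⟩ := mem_plane_iff.1 hw₁
    obtain ⟨z₂, rfl⟩ := mem_plane_iff.1 hw₂
    obtain ⟨z₃, rfl⟩ := mem_plane_iff.1 hw₃
    obtain ⟨z, rfl⟩ := mem_plane_iff.1 hz
    rw [mem_closedBall_zero_iff, norm_sliceEmb hI] at hw₁' hw₂' hw₃' hz'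
    exact ⟨((I, I), z₁, z₂, z₃, z),
      mem_diamParam.2 ⟨Set.mem_image_of_mem _ hI, hw₁', hw₂', hw₃', hz'⟩, rfl⟩
  · rintro ⟨⟨⟨I, J⟩, z₁, z₂, z₃, z⟩, h, rfl⟩
    obtain ⟨⟨K, hK, hKJ⟩, h₁, h₂, h₃, hz⟩ := mem_diamParam.1 h
    obtain ⟨rfl, rfl⟩ := Prod.ext_iff.1 hKJ
    dsimp only at hK h ⊢
    refine ⟨K, hK, sliceEmb K z₁, ⟨mem_plane_iff.2 ⟨z₁, rfl⟩, ?_⟩, sliceEmb K z₂,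
      ⟨mem_plane_iff.2 ⟨z₂, rfl⟩, ?_⟩, sliceEmb K z₃, ⟨mem_plane_iff.2 ⟨z₃, rfl⟩, ?_⟩,
      sliceEmb K z, ⟨mem_plane_iff.2 ⟨z, rfl⟩, ?_⟩, rfl⟩ <;>
    rwa [mem_closedBall_zero_iff, norm_sliceEmb hK]

theorem isCompact_imagUnits : IsCompact imagUnits := by
  have : ProperSpace ℍ[ℝ] := FiniteDimensional.proper ℝ _
  refine Metric.isCompact_of_isClosed_isBounded ?_ ?_
  · exact isClosed_eq (continuous_id.mul continuous_id) continuous_const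
  · refine (Metric.isBounded_closedBall (x := (0 : ℍ[ℝ])) (r := 1)).subset fun I hI => ?_
    rw [mem_closedBall_zero_iff, norm_of_mem_imagUnits hI]

theorem isCompact_diamParam {P : Set (ℍ[ℝ] × ℍ[ℝ])} (hP : IsCompact P) (r : ℝ) :
    IsCompact (diamParam P r) :=
  hP.prod ((isCompact_closedBall _ _).prod ((isCompact_closedBall _ _).prod
    ((isCompact_closedBall _ _).prod (isCompact_closedBall _ _))))

theorem continuousOn_gParam {f : ℍ[ℝ] → ℍ[ℝ]} (hf : IsSliceRegular f)
    {P : Set (ℍ[ℝ] × ℍ[ℝ])} (hP : P ⊆ imagUnits ×ˢ imagUnits) {r : ℝ} (h0 : 0 ≤ r) (h1 : r < 1) :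
    ContinuousOn (gParam f) (diamParam P r) := by
  unfold gParam
  simp only [gHat_eq_tsum]
  refine continuousOn_tsum (u := fun n => gMajorant (normCoeff f) n * r ^ n) (fun n => ?_)
    (summable_gMajorant (hf.convergesOnBall_normCoeff r h0 h1)) ?_
  · refine Continuous.continuousOn ?_
    have e1 : Continuous fun p : (ℍ[ℝ] × ℍ[ℝ]) × (ℂ × ℂ × ℂ × ℂ) => sliceEmb p.1.1 p.2.1 :=
      continuous_sliceEmb.comp (by fun_prop : Continuous fun p :
        (ℍ[ℝ] × ℍ[ℝ]) × (ℂ × ℂ × ℂ × ℂ) => (p.1.1, p.2.1))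
    have e2 : Continuous fun p : (ℍ[ℝ] × ℍ[ℝ]) × (ℂ × ℂ × ℂ × ℂ) => sliceEmb p.1.1 p.2.2.1 :=
      continuous_sliceEmb.comp (by fun_prop : Continuous fun p :
        (ℍ[ℝ] × ℍ[ℝ]) × (ℂ × ℂ × ℂ × ℂ) => (p.1.1, p.2.2.1))
    have e3 : Continuous fun p : (ℍ[ℝ] × ℍ[ℝ]) × (ℂ × ℂ × ℂ × ℂ) => sliceEmb p.1.1 p.2.2.2.1 :=
      continuous_sliceEmb.comp (by fun_prop : Continuous fun p :
        (ℍ[ℝ] × ℍ[ℝ]) × (ℂ × ℂ × ℂ × ℂ) => (p.1.1, p.2.2.2.1))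
    have e4 : Continuous fun p : (ℍ[ℝ] × ℍ[ℝ]) × (ℂ × ℂ × ℂ × ℂ) => sliceEmb p.1.2 p.2.2.2.2 :=
      continuous_sliceEmb.comp (by fun_prop : Continuous fun p :
        (ℍ[ℝ] × ℍ[ℝ]) × (ℂ × ℂ × ℂ × ℂ) => (p.1.2, p.2.2.2.2))
    unfold gCoeff
    fun_prop
  · rintro n ⟨⟨I, J⟩, z₁, z₂, z₃, z⟩ h
    obtain ⟨hIJ, h₁, h₂, h₃, hz⟩ := mem_diamParam.1 h
    obtain ⟨hI, hJ⟩ := hP hIJ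
    dsimp only at hI hJ ⊢
    rw [norm_mul, norm_pow, norm_sliceEmb hJ, mul_comm]
    refine mul_le_mul (norm_gCoeff_le _ ?_ ?_ ?_ n) (pow_le_pow_left₀ (norm_nonneg z) hz n)
      (by positivity) ((norm_nonneg _).trans (norm_gCoeff_le _ (w₁ := 0) (w₂ := 0) (w₃ := 0)
        (by simp) (by simp) (by simp) n)) <;> rwa [norm_sliceEmb hI]

theorem exists_isMaxOn_gParam {f : ℍ[ℝ] → ℍ[ℝ]} (hf : IsSliceRegular f)
    {P : Set (ℍ[ℝ] × ℍ[ℝ])} (hP : P ⊆ imagUnits ×ˢ imagUnits) (hPc : IsCompact P)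
    (hPn : P.Nonempty) {r : ℝ} (h0 : 0 ≤ r) (h1 : r < 1) :
    ∃ p ∈ diamParam P r, pairDiam3 f P r = ‖gParam f p‖ ^ (1 / 3 : ℝ) ∧
      ∀ q ∈ diamParam P r, ‖gParam f q‖ ^ (1 / 3 : ℝ) ≤ pairDiam3 f P r := by
  obtain ⟨⟨I, J⟩, hIJ⟩ := hPn
  have hne : (diamParam P r).Nonempty :=
    ⟨((I, J), 0, 0, 0, 0), mem_diamParam.2 ⟨hIJ, by simp, by simp, by simp, by simpa using h0⟩⟩
  have hcont : ContinuousOn (fun p => ‖gParam f p‖ ^ (1 / 3 : ℝ)) (diamParam P r) :=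
    (continuousOn_gParam hf hP h0 h1).norm.rpow_const fun _ _ => Or.inr (by norm_num)
  obtain ⟨p, hp, hmax⟩ := (isCompact_diamParam hPc r).exists_isMaxOn hne hcont
  have hgr : IsGreatest ((fun p => ‖gParam f p‖ ^ (1 / 3 : ℝ)) '' diamParam P r)
      (‖gParam f p‖ ^ (1 / 3 : ℝ)) :=
    ⟨⟨p, hp, rfl⟩, by rintro _ ⟨q, hq, rfl⟩; exact hmax hq⟩
  have he : pairDiam3 f P r = ‖gParam f p‖ ^ (1 / 3 : ℝ) := hgr.csSup_eq
  exact ⟨p, hp, he, fun q hq => he ▸ hmax hq⟩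

theorem rpow_one_third_pow_three {x : ℝ} (hx : 0 ≤ x) : (x ^ (1 / 3 : ℝ)) ^ 3 = x := by
  rw [← Real.rpow_natCast, ← Real.rpow_mul hx]
  norm_num

/-! ### Strict monotonicity and the affine case -/

/-- The set `P` covers both variants: all pairs of units, or the diagonal. The diagonal suffices
because the parameters exceeding the bound have `z` in the plane of the `wᵢ`. -/
theorem strictMonoOn_pairDiam3 {f : ℍ[ℝ] → ℍ[ℝ]} (hf : IsSliceRegular f)
    {P : Set (ℍ[ℝ] × ℍ[ℝ])} (hP : P ⊆ imagUnits ×ˢ imagUnits) (hPc : IsCompact P)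
    (hdiag : ∀ I ∈ imagUnits, (I, I) ∈ P) {d : ℝ} (hd : 0 < d) (haff : ¬ IsAffineOnBall f) :
    StrictMonoOn (fun r : ℝ => pairDiam3 f P r / (d * r)) (Set.Ioo 0 1) := by
  rintro r ⟨hr0, hr1⟩ s ⟨hs0, hs1⟩ hrs
  have hPn : P.Nonempty := by
    obtain ⟨I, hI⟩ := imagUnits_nonempty
    exact ⟨_, hdiag I hI⟩
  have hb := hf.convergesOnBall_normCoeff
  obtain ⟨⟨⟨I, J⟩, z₁, z₂, z₃, z⟩, hp, hDr, -⟩ := exists_isMaxOn_gParam hf hP hPc hPn hr0.le hr1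
  obtain ⟨-, -, -, hDs⟩ := exists_isMaxOn_gParam hf hP hPc hPn hs0.le hs1
  obtain ⟨hIJ, h₁, h₂, h₃, hz⟩ := mem_diamParam.1 hp
  obtain ⟨hI, hJ⟩ := hP hIJ
  dsimp only at hI hJ ⊢
  by_contra! hcon
  rw [div_le_div_iff₀ (by positivity) (by positivity)] at hcon
  have hcon' : pairDiam3 f P s * r ≤ pairDiam3 f P r * s := by
    refine le_of_mul_le_mul_left ?_ hd
    linarith
  set K := ‖powerSum (hCoeff (normCoeff f) (sliceEmb I z₁) (sliceEmb I z₂) (sliceEmb I z₃))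
    (sliceEmb J z)‖ with hK
  have hgp : ‖gParam f ((I, J), z₁, z₂, z₃, z)‖ ≤ r ^ 3 * K := by
    rw [gParam, norm_gHat hf (by rwa [norm_sliceEmb hI]) (by rwa [norm_sliceEmb hI])
      (by rwa [norm_sliceEmb hI]) (by rw [norm_sliceEmb hJ]; exact hz.trans_lt hr1),
      norm_sliceEmb hJ]
    gcongr
  -- On `|y| = s` the negated inequality, cubed, cancels to `|h| ≤ K`; the maximum principle extends
  -- it to the disc.
  have hbound : ∀ I' J', (I', J') ∈ P → ∀ y₁ y₂ y₃ : ℂ, ‖y₁‖ ≤ 1 → ‖y₂‖ ≤ 1 → ‖y₃‖ ≤ 1 →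
      ∀ y : ℂ, ‖y‖ ≤ s → ‖powerSum (hCoeff (normCoeff f) (sliceEmb I' y₁) (sliceEmb I' y₂)
        (sliceEmb I' y₃)) (sliceEmb J' y)‖ ≤ K := by
    intro I' J' hIJ' y₁ y₂ y₃ hy₁ hy₂ hy₃ y hy
    obtain ⟨hI', hJ'⟩ := hP hIJ'
    dsimp only at hI' hJ'
    have n₁ : ‖sliceEmb I' y₁‖ ≤ 1 := by rwa [norm_sliceEmb hI']
    have n₂ : ‖sliceEmb I' y₂‖ ≤ 1 := by rwa [norm_sliceEmb hI']
    have n₃ : ‖sliceEmb I' y₃‖ ≤ 1 := by rwa [norm_sliceEmb hI']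
    refine (hb.hCoeff n₁ n₂ n₃).norm_powerSum_le hJ' hs0 hs1 (fun x hx => ?_) hy
    have h := (mul_le_mul_of_nonneg_right (hDs ((I', J'), y₁, y₂, y₃, x)
      (mem_diamParam.2 ⟨hIJ', hy₁, hy₂, hy₃, hx.le⟩)) hr0.le).trans hcon'
    have h3 := pow_le_pow_left₀ (by positivity) h 3
    rw [hDr, mul_pow, mul_pow, rpow_one_third_pow_three (norm_nonneg _),
      rpow_one_third_pow_three (norm_nonneg _), gParam,
      norm_gHat hf n₁ n₂ n₃ (by rw [norm_sliceEmb hJ']; exact hx.trans_lt hs1),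
      norm_sliceEmb hJ', hx] at h3
    have h4 := h3.trans (mul_le_mul_of_nonneg_right hgp (by positivity : 0 ≤ s ^ 3))
    have h5 : (0 : ℝ) < s ^ 3 * r ^ 3 := by positivity
    refine le_of_mul_le_mul_left ?_ h5
    linarith
  have hK0 : K ≤ 3 * √3 * ‖normCoeff f 1‖ ^ 3 := by
    have h := (hb.hCoeff (w₁ := sliceEmb I z₁) (w₂ := sliceEmb I z₂) (w₃ := sliceEmb I z₃)
      (by rwa [norm_sliceEmb hI]) (by rwa [norm_sliceEmb hI])
      (by rwa [norm_sliceEmb hI])).le_norm_coeff_zero hJ hs1.le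
      (fun y hy => hbound I J hIJ z₁ z₂ z₃ h₁ h₂ h₃ y hy.le) (hz.trans_lt hrs) le_rfl
    rw [hCoeff_zero _ I hI, norm_mul, norm_mul, norm_mul, norm_sliceEmb hI] at h
    have hV := norm_vandermonde_three_le h₁ h₂ h₃
    refine (h : K ≤ _).trans ?_
    calc _ = ‖(z₂ - z₁) * (z₃ - z₁) * (z₃ - z₂)‖ * ‖normCoeff f 1‖ ^ 3 := by ring
      _ ≤ _ := by gcongr
  have hne : ∃ n, 2 ≤ n ∧ normCoeff f n ≠ 0 := by
    rw [hf.isAffineOnBall_iff] at haff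
    push Not at haff
    simpa only [ne_eq, normCoeff_eq_zero_iff] using haff
  obtain ⟨I', hI', y₁, y₂, y₃, hy₁, hy₂, hy₃, y, hy, hgt⟩ :=
    exists_norm_hCoeff_gt hb hne hs0 hs1.le
  have := hbound I' I' (hdiag I' hI') y₁ y₂ y₃ hy₁ hy₂ hy₃ y hy.le
  linarith

theorem powerSum_hCoeff_of_forall_eq_zero {b : ℕ → ℍ[ℝ]} (hb : ∀ n, 2 ≤ n → b n = 0)
    (w₁ w₂ w₃ z : ℍ[ℝ]) : powerSum (hCoeff b w₁ w₂ w₃) z = hCoeff b w₁ w₂ w₃ 0 := by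
  have h : ∀ n, n ≠ 0 → hCoeff b w₁ w₂ w₃ n = 0 := fun n hn =>
    sum_range_triple_eq_zero (fun j l i => (w₂ ^ j - w₁ ^ j) * (w₃ ^ l - w₁ ^ l) *
      (w₃ ^ i - w₂ ^ i) * b j * b l * b i) (n + 3) fun j l i h => by
        have : 2 ≤ j ∨ 2 ≤ l ∨ 2 ≤ i := by omega
        rcases this with h | h | h <;> simp [hb _ h]
  rw [powerSum, tsum_eq_single 0 fun n hn => by rw [h n hn, mul_zero], pow_zero, one_mul]

theorem not_strictMonoOn_pairDiam3 {f : ℍ[ℝ] → ℍ[ℝ]} (hf : IsSliceRegular f)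
    {P : Set (ℍ[ℝ] × ℍ[ℝ])} (hP : P ⊆ imagUnits ×ˢ imagUnits) (hPc : IsCompact P)
    (hPn : P.Nonempty) {d : ℝ} (hd : 0 < d) (haff : IsAffineOnBall f) :
    ¬ StrictMonoOn (fun r : ℝ => pairDiam3 f P r / (d * r)) (Set.Ioo 0 1) := by
  intro hmono
  have h := hmono (a := 1 / 4) (b := 1 / 2) (by norm_num) (by norm_num) (by norm_num)
  dsimp only at h
  rw [div_lt_div_iff₀ (by positivity) (by positivity)] at h
  have h' : 2 * pairDiam3 f P (1 / 4) < pairDiam3 f P (1 / 2) := by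
    refine lt_of_mul_lt_mul_left ?_ hd.le
    linarith
  have hb0 : ∀ n, 2 ≤ n → normCoeff f n = 0 := fun n hn =>
    (normCoeff_eq_zero_iff f n).2 (hf.isAffineOnBall_iff.1 haff n hn)
  obtain ⟨⟨⟨I, J⟩, z₁, z₂, z₃, z⟩, hp, hD, -⟩ :=
    exists_isMaxOn_gParam hf hP hPc hPn (r := 1 / 2) (by norm_num) (by norm_num)
  obtain ⟨-, -, -, hD'⟩ :=
    exists_isMaxOn_gParam hf hP hPc hPn (r := 1 / 4) (by norm_num) (by norm_num)
  obtain ⟨hIJ, h₁, h₂, h₃, hz⟩ := mem_diamParam.1 hp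
  obtain ⟨hI, hJ⟩ := hP hIJ
  dsimp only at hI hJ
  -- A maximizer `z` for radius 1/2 gives the competitor `z / 2` for radius 1/4, where `|ĝ|` is
  -- exactly 8 times smaller.
  have hz2 : ‖z / 2‖ = ‖z‖ / 2 := by simp
  have hq := hD' ((I, J), z₁, z₂, z₃, z / 2)
    (mem_diamParam.2 ⟨hIJ, h₁, h₂, h₃, by rw [hz2]; linarith⟩)
  have hg : ∀ y : ℂ, ‖y‖ < 1 → ‖gParam f ((I, J), z₁, z₂, z₃, y)‖ =
      ‖y‖ ^ 3 * ‖hCoeff (normCoeff f) (sliceEmb I z₁) (sliceEmb I z₂) (sliceEmb I z₃) 0‖ := by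
    intro y hy
    rw [gParam, norm_gHat hf (by rwa [norm_sliceEmb hI]) (by rwa [norm_sliceEmb hI])
      (by rwa [norm_sliceEmb hI]) (by rwa [norm_sliceEmb hJ]), norm_sliceEmb hJ,
      powerSum_hCoeff_of_forall_eq_zero hb0]
  have e : ‖gParam f ((I, J), z₁, z₂, z₃, z)‖ =
      2 ^ 3 * ‖gParam f ((I, J), z₁, z₂, z₃, z / 2)‖ := by
    rw [hg z (by linarith), hg (z / 2) (by rw [hz2]; linarith), hz2]
    ring
  have e2 : ((2 : ℝ) ^ 3) ^ (1 / 3 : ℝ) = 2 := by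
    rw [← Real.rpow_natCast, ← Real.rpow_mul (by norm_num)]
    norm_num
  rw [e, Real.mul_rpow (by norm_num) (norm_nonneg _), e2] at hD
  linarith

theorem nDiam_three_ball_pos : 0 < nDiam 3 (Metric.ball (0 : ℍ[ℝ]) 1) := by
  have hexp : (0 : ℝ) ≤ 2 / (((3 : ℕ) : ℝ) * (((3 : ℕ) : ℝ) - 1)) := by norm_num
  set w : Fin 3 → ℍ[ℝ] := fun i => (((i : ℕ) : ℝ) / 4 : ℝ) with hw
  have hwinj : ∀ j k : Fin 3, j < k → 0 < ‖w k - w j‖ := by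
    intro j k hjk
    rw [norm_pos_iff, sub_ne_zero, hw]
    intro h
    have h1 : ((k : ℕ) : ℝ) / 4 = ((j : ℕ) : ℝ) / 4 := Quaternion.coe_injective h
    have h2 : ((j : ℕ) : ℝ) < ((k : ℕ) : ℝ) := by exact_mod_cast hjk
    linarith
  have hpos : 0 < (∏ j : Fin 3, ∏ k ∈ Finset.Ioi j, ‖w k - w j‖) ^
      (2 / (((3 : ℕ) : ℝ) * (((3 : ℕ) : ℝ) - 1))) :=
    Real.rpow_pos_of_pos (Finset.prod_pos fun j _ => Finset.prod_pos fun k hk =>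
      hwinj j k (Finset.mem_Ioi.1 hk)) _
  -- Boundedness above is needed because `sSup` of an unbounded set is 0; each distance in the unit
  -- ball is at most 2.
  refine hpos.trans_le (le_csSup ⟨(∏ j : Fin 3, ∏ k ∈ Finset.Ioi j, (2 : ℝ)) ^
      (2 / (((3 : ℕ) : ℝ) * (((3 : ℕ) : ℝ) - 1))), ?_⟩ ⟨w, fun i => ?_, rfl⟩)
  · rintro _ ⟨u, hu, rfl⟩
    refine Real.rpow_le_rpow (by positivity) ?_ hexp
    refine Finset.prod_le_prod (fun _ _ => by positivity) fun j _ =>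
      Finset.prod_le_prod (fun _ _ => by positivity) fun k _ => ?_
    have h1 := mem_ball_zero_iff.1 (hu j)
    have h2 := mem_ball_zero_iff.1 (hu k)
    linarith [norm_sub_le (u k) (u j)]
  · rw [mem_ball_zero_iff, hw]
    simp only [Quaternion.norm_coe, Real.norm_eq_abs]
    have h1 : ((i : ℕ) : ℝ) ≤ 2 := by exact_mod_cast Nat.lt_succ_iff.1 i.isLt
    rw [abs_of_nonneg (by positivity)]
    linarith

end SliceRegular

end

theorem theorem5 (f : ℍ[ℝ] → ℍ[ℝ]) (hf : SliceRegular.IsSliceRegular f) :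
    (StrictMonoOn
        (fun r : ℝ => SliceRegular.sliceDiam3 f r /
          (SliceRegular.nDiam 3 (Metric.ball (0 : ℍ[ℝ]) 1) * r))
        (Set.Ioo 0 1) ↔ ¬ SliceRegular.IsAffineOnBall f) ∧
    (StrictMonoOn
        (fun r : ℝ => SliceRegular.planeDiam3 f r /
          (SliceRegular.nDiam 3 (Metric.ball (0 : ℍ[ℝ]) 1) * r))
        (Set.Ioo 0 1) ↔ ¬ SliceRegular.IsAffineOnBall f) := by
  have hd := SliceRegular.nDiam_three_ball_pos
  have key : ∀ P : Set (ℍ[ℝ] × ℍ[ℝ]), P ⊆ SliceRegular.imagUnits ×ˢ SliceRegular.imagUnits →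
      IsCompact P → (∀ I ∈ SliceRegular.imagUnits, (I, I) ∈ P) →
      (StrictMonoOn (fun r : ℝ => SliceRegular.pairDiam3 f P r /
        (SliceRegular.nDiam 3 (Metric.ball (0 : ℍ[ℝ]) 1) * r)) (Set.Ioo 0 1) ↔
        ¬ SliceRegular.IsAffineOnBall f) := fun P hP hPc hdiag => by
    obtain ⟨I, hI⟩ := SliceRegular.imagUnits_nonempty
    exact ⟨fun h haff => SliceRegular.not_strictMonoOn_pairDiam3 hf hP hPc ⟨_, hdiag I hI⟩ hd haff h,
      SliceRegular.strictMonoOn_pairDiam3 hf hP hPc hdiag hd⟩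
  simp only [SliceRegular.sliceDiam3_eq, SliceRegular.planeDiam3_eq]
  refine ⟨key _ subset_rfl
    (SliceRegular.isCompact_imagUnits.prod SliceRegular.isCompact_imagUnits)
    fun I hI => ⟨hI, hI⟩, key _ ?_ ?_ fun I hI => ⟨I, hI, rfl⟩⟩
  · rintro _ ⟨I, hI, rfl⟩
    exact ⟨hI, hI⟩
  · exact SliceRegular.isCompact_imagUnits.image (by fun_prop)
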